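/- Let $M_{11}$ be the Mathieu group on eleven points, realised as the group of permutations of $\{0,1,\dots,10\}$ generated by $(0\,1\,2\,3\,4\,5\,6\,7\,8\,9\,10)$ and $(2\,6\,10\,7)(3\,9\,4\,5)$. An automorphism $\phi$ of a group $G$ is called class-inverting if for every $g\in G$ there is $h\in G$ with $\phi(g)=hg^{-1}h^{-1}$. For an algebraically closed field $k$ of characteristic zero and a finite group $G$, let $\mathcal Z(G)$ be the category of finite-dimensional $G$-graded $k$-vector spaces $V=\bigoplus_{g\in G}V_g$ with a $G$-action satisfying $f(V_g)=V_{fgf^{-1}}$; morphisms are the linear maps preserving grading and action. It is a $k$-linear braided rigid monoidal category: $(V\otimes U)_f=\bigoplus_{ab=f}V_a\otimes U_b$ with the diagonal action and the associativity constraint of vector spaces; the braiding is $v\otimes u\mapsto f(u)\otimes v$ for $v\in V_f$; the dual is $V^*=\mathrm{Hom}_k(V,k)$ with $(V^*)_g=(V_{g^{-1}})^*$ and $(f\cdot l)(v)=l(f^{-1}v)$. A dualising braided autoequivalence of $\mathcal Z(G)$ is a $k$-linear braided (strong) monoidal functor $F:\mathcal Z(G)\to\mathcal Z(G)$ that is an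 equivalence of categories and satisfies $F(X)\simeq X^*$ for every object $X$. Then: 1. $|M_{11}|=7920$ and $\mathrm{Out}(M_{11})=1$. 2. $M_{11}$ has exactly $144$ Sylow $11$-subgroups, and the normaliser of each of them has order $55$. 3. $M_{11}$ has elements of order $11$, and no element of order $11$ is conjugate to its inverse. 4. Some complex irreducible character of $M_{11}$ is not real-valued. 5. $M_{11}$ has no class-inverting automorphism. 6. For every algebraically closed field $k$ of characteristic zero, the Drinfeld centre $\mathcal Z(M_{11})$ over $k$ has no dualising braided autoequivalence. -/

import Mathlib

open CategoryTheory MonoidalCategory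

universe w v u

/-! ### Group-theoretic notions -/

section Groups

/-- The Mathieu group `M₁₁`, as the group of permutations of eleven points generated by
`(0 1 2 3 4 5 6 7 8 9 10)` and `(2 6 10 7)(3 9 4 5)`. -/
def MathieuM11 : Subgroup (Equiv.Perm (Fin 11)) :=
  Subgroup.closure {c[0, 1, 2, 3, 4, 5, 6, 7, 8, 9, 10], c[2, 6, 10, 7] * c[3, 9, 4, 5]}

/-- The inner automorphisms form a normal subgroup of the automorphism group. -/
instance innerAutomorphisms_normal (G : Type v) [Group G] :
    (MulAut.conj : G →* MulAut G).range.Normal where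
  conj_mem := by
    rintro _ ⟨g, rfl⟩ φ
    exact ⟨φ g, by ext x; simp⟩

/-- The group of outer automorphisms `Out(G) = Aut(G) / Inn(G)`. -/
abbrev OuterAut (G : Type v) [Group G] : Type v :=
  MulAut G ⧸ (MulAut.conj : G →* MulAut G).range

/-- An automorphism is class-inverting if it sends every element into the conjugacy class of its
inverse. -/
def IsClassInverting {G : Type v} [Group G] (φ : MulAut G) : Prop :=
  ∀ g : G, ∃ h : G, φ g = h * g⁻¹ * h⁻¹

end Groups

/-! ### Dualising autoequivalences -/

section Dualising

/-- A functor on a rigid monoidal category is dualising if `F X ≅ X*` for every object `X`. -/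
def IsDualising {C : Type u} [Category.{v} C] [MonoidalCategory C] [RightRigidCategory C]
    (F : C ⥤ C) : Prop :=
  ∀ X : C, Nonempty (F.obj X ≅ Xᘁ)

/-- The `k`-linear braided rigid monoidal category `C` has a dualising braided autoequivalence:
a `k`-linear braided (strong) monoidal functor `F : C ⥤ C` which is an equivalence of categories
and is dualising. -/
def HasDualisingBraidedAutoequivalence (k : Type w) [Field k] (C : Type u) [Category.{v} C]
    [MonoidalCategory C] [BraidedCategory C] [RightRigidCategory C] [Preadditive C]
    [CategoryTheory.Linear k C] : Prop :=
  ∃ (F : C ⥤ C) (_ : F.Braided), F.IsEquivalence ∧ F.Additive ∧ F.Linear k ∧ IsDualising F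

end Dualising

/-! ### The Drinfeld centre of a group -/

/-- An object of the Drinfeld centre `Z(G)` over `k`: a finite-dimensional `G`-graded `k`-vector
space `V = ⨁ g, V_g` with a compatible action of `G`, i.e. `f (V_g) = V_{f g f⁻¹}`. -/
structure DrinfeldCentre (k : Type u) [Field k] (G : Type v) [Group G] where
  /-- the underlying vector space -/
  carrier : Type u
  [addCommGroup : AddCommGroup carrier]
  [module : Module k carrier]
  [finite : Module.Finite k carrier]
  /-- the action of `G` -/
  ρ : Representation k G carrier
  /-- the homogeneous components -/
  grading : G → Submodule k carrier
  indep : iSupIndep grading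
  iSup_eq_top : ⨆ g, grading g = ⊤
  compatible : ∀ f g : G, (grading g).map (ρ f) = grading (f * g * f⁻¹)

namespace DrinfeldCentre

noncomputable section

open TensorProduct

attribute [instance] addCommGroup module finite

variable {k : Type u} [Field k] {G : Type v} [Group G]

instance : CoeSort (DrinfeldCentre k G) (Type u) := ⟨carrier⟩

/-! #### Graded linear algebra -/

/-- The universal property of the direct sum decomposition `V = ⨁ g, V_g`. -/
def lift (V : DrinfeldCentre k G) {M : Type*} [AddCommGroup M] [Module k M]
    (φ : ∀ g, V.grading g →ₗ[k] M) : V →ₗ[k] M := by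
  classical
  exact DFinsupp.lsum k φ ∘ₗ (V.indep.linearEquiv V.iSup_eq_top).symm.toLinearMap

theorem lift_apply (V : DrinfeldCentre k G) {M : Type*} [AddCommGroup M] [Module k M]
    (φ : ∀ g, V.grading g →ₗ[k] M) {g : G} {v : V} (hv : v ∈ V.grading g) :
    V.lift φ v = φ g ⟨v, hv⟩ := by
  classical
  simp only [lift, LinearMap.comp_apply, LinearEquiv.coe_coe]
  rw [V.indep.linearEquiv_symm_apply V.iSup_eq_top hv]
  simp

theorem induction_grading (V : DrinfeldCentre k G) {p : V → Prop}
    (hom : ∀ g, ∀ v ∈ V.grading g, p v) (zero : p 0) (plus : ∀ v w, p v → p w → p (v + w))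
    (v : V) : p v :=
  Submodule.iSup_induction V.grading (motive := p) (by rw [V.iSup_eq_top]; trivial) hom zero plus

theorem linearMap_ext (V : DrinfeldCentre k G) {M : Type*} [AddCommGroup M] [Module k M]
    {φ ψ : V →ₗ[k] M} (h : ∀ g, ∀ v ∈ V.grading g, φ v = ψ v) : φ = ψ := by
  ext v
  induction v using V.induction_grading with
  | hom g v hv => exact h g v hv
  | zero => simp
  | plus v w hv hw => simp [hv, hw]

/-- The projection of `V` onto its homogeneous component of degree `g`. -/
def proj (V : DrinfeldCentre k G) (g : G) : V →ₗ[k] V := by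
  classical
  exact V.lift fun h => if h = g then (V.grading h).subtype else 0

theorem proj_same (V : DrinfeldCentre k G) {g : G} {v : V} (hv : v ∈ V.grading g) :
    V.proj g v = v := by
  simp [proj, V.lift_apply _ hv]

theorem proj_ne (V : DrinfeldCentre k G) {g h : G} (hgh : h ≠ g) {v : V}
    (hv : v ∈ V.grading h) : V.proj g v = 0 := by
  simp [proj, V.lift_apply _ hv, hgh]

theorem proj_mem (V : DrinfeldCentre k G) (g : G) (v : V) : V.proj g v ∈ V.grading g := by
  induction v using V.induction_grading with
  | hom h v hv =>
    by_cases hgh : h = g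
    · subst hgh; rwa [V.proj_same hv]
    · rw [V.proj_ne hgh hv]; exact zero_mem _
  | zero => simp
  | plus v w hv hw => rw [map_add]; exact add_mem hv hw

theorem sum_proj (V : DrinfeldCentre k G) [Fintype G] (v : V) : ∑ g, V.proj g v = v := by
  induction v using V.induction_grading with
  | hom h v hv =>
    rw [Finset.sum_eq_single h (fun g _ hg => V.proj_ne (Ne.symm hg) hv) (by simp),
      V.proj_same hv]
  | zero => simp
  | plus v w hv hw => simp [Finset.sum_add_distrib, hv, hw]

theorem iSupIndep_of_proj {G : Type v} {M : Type*} [AddCommGroup M] [Module k M] {A : G → Submodule k M}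
    (q : G → M →ₗ[k] M) (h_same : ∀ g, ∀ m ∈ A g, q g m = m)
    (h_ne : ∀ g h, h ≠ g → ∀ m ∈ A h, q g m = 0) : iSupIndep A := by
  intro g
  rw [Submodule.disjoint_def]
  intro m hm hm'
  have hle : ⨆ h, ⨆ _ : h ≠ g, A h ≤ LinearMap.ker (q g) :=
    iSup₂_le fun h hh m hm => h_ne g h hh m hm
  rw [← h_same g m hm]
  exact hle hm'

theorem compatible_of_le {M : Type*} [AddCommGroup M] [Module k M] (ρ : Representation k G M)
    {A : G → Submodule k M} (h : ∀ f g, ∀ m ∈ A g, ρ f m ∈ A (f * g * f⁻¹)) (f g : G) :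
    (A g).map (ρ f) = A (f * g * f⁻¹) := by
  apply le_antisymm
  · rintro _ ⟨m, hm, rfl⟩
    exact h f g m hm
  · intro m hm
    refine ⟨ρ f⁻¹ m, ?_, by simp⟩
    have := h f⁻¹ _ m hm
    simpa [mul_assoc] using this

theorem ρ_mem (V : DrinfeldCentre k G) (f : G) {g : G} {v : V} (hv : v ∈ V.grading g) :
    V.ρ f v ∈ V.grading (f * g * f⁻¹) := by
  rw [← V.compatible]
  exact Submodule.mem_map_of_mem hv

/-! #### The category -/

/-- Morphisms in `Z(G)`: linear maps preserving the grading and the action. -/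
@[ext]
structure Hom (V W : DrinfeldCentre k G) where
  /-- the underlying linear map -/
  hom : V →ₗ[k] W
  map_mem : ∀ g, ∀ v ∈ V.grading g, hom v ∈ W.grading g
  map_ρ : ∀ g v, hom (V.ρ g v) = W.ρ g (hom v)

instance : Category (DrinfeldCentre k G) where
  Hom := Hom
  id V := ⟨LinearMap.id, fun _ _ hv => hv, fun _ _ => rfl⟩
  comp f g := ⟨g.hom ∘ₗ f.hom, fun a v hv => g.map_mem a _ (f.map_mem a v hv),
    fun a v => by simp [f.map_ρ, g.map_ρ]⟩

@[ext]
theorem hom_ext {V W : DrinfeldCentre k G} {f g : V ⟶ W} (h : f.hom = g.hom) : f = g :=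
  Hom.ext h

@[simp] theorem id_hom (V : DrinfeldCentre k G) : (𝟙 V : V ⟶ V).hom = LinearMap.id := rfl

@[simp] theorem comp_hom {U V W : DrinfeldCentre k G} (f : U ⟶ V) (g : V ⟶ W) :
    (f ≫ g).hom = g.hom ∘ₗ f.hom := rfl

/-- A linear equivalence preserving the grading and the action is an isomorphism in `Z(G)`. -/
@[simps]
def isoMk {V W : DrinfeldCentre k G} (e : V ≃ₗ[k] W)
    (h_mem : ∀ g, ∀ v ∈ V.grading g, e v ∈ W.grading g)
    (h_ρ : ∀ g v, e (V.ρ g v) = W.ρ g (e v)) : V ≅ W where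
  hom := ⟨e.toLinearMap, h_mem, h_ρ⟩
  inv := ⟨e.symm.toLinearMap, fun g w hw => by
    have key : ∀ h, V.proj h (e.symm w) = e.symm (W.proj h w) := by
      intro h
      have : V.proj h = e.symm.toLinearMap ∘ₗ W.proj h ∘ₗ e.toLinearMap := by
        refine V.linearMap_ext fun a v hv => ?_
        by_cases hah : a = h
        · subst hah
          simp [V.proj_same hv, W.proj_same (h_mem _ v hv)]
        · simp [V.proj_ne hah hv, W.proj_ne hah (h_mem _ v hv)]
      rw [this]; simp
    have := key g
    rw [W.proj_same hw] at this
    change e.symm w ∈ _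
    rw [← this]
    exact V.proj_mem g _, fun g w => by
      apply e.injective
      simp [h_ρ]⟩
  hom_inv_id := by ext; simp
  inv_hom_id := by ext; simp

/-! #### The linear structure -/

/-- The space of morphisms as a subspace of the space of linear maps. -/
def homSubmodule (V W : DrinfeldCentre k G) : Submodule k (V →ₗ[k] W) where
  carrier := {φ | (∀ g, ∀ v ∈ V.grading g, φ v ∈ W.grading g) ∧
    ∀ g v, φ (V.ρ g v) = W.ρ g (φ v)}
  add_mem' hφ hψ := ⟨fun g v hv => add_mem (hφ.1 g v hv) (hψ.1 g v hv),
    fun g v => by simp [hφ.2, hψ.2]⟩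
  zero_mem' := ⟨fun _ _ _ => zero_mem _, fun _ _ => by simp⟩
  smul_mem' c _ hφ := ⟨fun g v hv => Submodule.smul_mem _ c (hφ.1 g v hv),
    fun g v => by simp [hφ.2]⟩

/-- Morphisms are the elements of `homSubmodule`. -/
def homEquiv (V W : DrinfeldCentre k G) : (V ⟶ W) ≃ homSubmodule V W where
  toFun f := ⟨f.hom, f.map_mem, f.map_ρ⟩
  invFun φ := ⟨φ.1, φ.2.1, φ.2.2⟩
  left_inv _ := rfl
  right_inv _ := rfl

instance (V W : DrinfeldCentre k G) : AddCommGroup (V ⟶ W) := (homEquiv V W).addCommGroup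

instance (V W : DrinfeldCentre k G) : Module k (V ⟶ W) := (homEquiv V W).module k

@[simp] theorem add_hom {V W : DrinfeldCentre k G} (f g : V ⟶ W) :
    (f + g).hom = f.hom + g.hom := rfl

@[simp] theorem smul_hom {V W : DrinfeldCentre k G} (c : k) (f : V ⟶ W) :
    (c • f).hom = c • f.hom := rfl

instance : Preadditive (DrinfeldCentre k G) where
  add_comp _ _ _ f f' g := by ext; simp
  comp_add _ _ _ f g g' := by ext; simp

instance : CategoryTheory.Linear k (DrinfeldCentre k G) where
  smul_comp _ _ _ c f g := by ext; simp
  comp_smul _ _ _ f c g := by ext; simp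

/-! #### The tensor product -/

/-- The components `(V ⊗ W)_f = ⨁_{a b = f} V_a ⊗ W_b`. -/
def tensorGrading (V W : DrinfeldCentre k G) (f : G) : Submodule k (V ⊗[k] W) :=
  ⨆ a : G, Submodule.map₂ (TensorProduct.mk k V W) (V.grading a) (W.grading (a⁻¹ * f))

theorem tmul_mem {V W : DrinfeldCentre k G} {a b : G} {v : V} {w : W}
    (hv : v ∈ V.grading a) (hw : w ∈ W.grading b) :
    v ⊗ₜ[k] w ∈ tensorGrading V W (a * b) :=
  Submodule.mem_iSup_of_mem a
    (Submodule.apply_mem_map₂ (TensorProduct.mk k V W) hv (by simpa using hw))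

theorem tensorGrading_le {V W : DrinfeldCentre k G} {f : G} {N : Submodule k (V ⊗[k] W)}
    (h : ∀ a b, a * b = f → ∀ v ∈ V.grading a, ∀ w ∈ W.grading b, v ⊗ₜ[k] w ∈ N) :
    tensorGrading V W f ≤ N :=
  iSup_le fun a => Submodule.map₂_le.2 fun v hv w hw => h a (a⁻¹ * f) (by simp) v hv w hw

/-- The projection of `V ⊗ W` onto its component of degree `f`. -/
def tensorProj (V W : DrinfeldCentre k G) (f : G) : V ⊗[k] W →ₗ[k] V ⊗[k] W :=
  TensorProduct.lift <| V.lift fun a =>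
    ((LinearMap.lcomp k (V ⊗[k] W) (W.proj (a⁻¹ * f))) ∘ₗ TensorProduct.mk k V W) ∘ₗ
      (V.grading a).subtype

theorem tensorProj_tmul {V W : DrinfeldCentre k G} (f : G) {a : G} {v : V}
    (hv : v ∈ V.grading a) (w : W) :
    tensorProj V W f (v ⊗ₜ w) = v ⊗ₜ[k] W.proj (a⁻¹ * f) w := by
  simp [tensorProj, V.lift_apply _ hv]

/-- The tensor product of graded vector spaces with the diagonal action. -/
abbrev tensorObj (V W : DrinfeldCentre k G) : DrinfeldCentre k G where
  carrier := V ⊗[k] W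
  ρ := V.ρ.tprod W.ρ
  grading := tensorGrading V W
  indep := by
    refine iSupIndep_of_proj (tensorProj V W) (fun f m hm => ?_) (fun f f' hne m hm => ?_)
    · suffices tensorGrading V W f ≤ LinearMap.eqLocus (tensorProj V W f) LinearMap.id from
        this hm
      refine tensorGrading_le fun a b hab v hv w hw => ?_
      subst hab
      simp [tensorProj_tmul _ hv, W.proj_same hw]
    · suffices tensorGrading V W f' ≤ LinearMap.ker (tensorProj V W f) from this hm
      refine tensorGrading_le fun a b hab v hv w hw => ?_
      have : b ≠ a⁻¹ * f := by
        rintro rfl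
        exact hne (by simp [← hab])
      simp [tensorProj_tmul _ hv, W.proj_ne this hw]
  iSup_eq_top := by
    rw [eq_top_iff, ← TensorProduct.map₂_mk_top_top_eq_top, ← V.iSup_eq_top, ← W.iSup_eq_top,
      Submodule.map₂_iSup_left]
    refine iSup_le fun a => ?_
    rw [Submodule.map₂_iSup_right]
    refine iSup_le fun b => Submodule.map₂_le.2 fun v hv w hw => ?_
    exact Submodule.mem_iSup_of_mem (a * b) (tmul_mem hv hw)
  compatible := by
    refine compatible_of_le _ fun f g m hm => ?_
    suffices tensorGrading V W g ≤
        (tensorGrading V W (f * g * f⁻¹)).comap (V.ρ.tprod W.ρ f) from this hm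
    refine tensorGrading_le fun a b hab v hv w hw => ?_
    have : f * g * f⁻¹ = (f * a * f⁻¹) * (f * b * f⁻¹) := by simp [← hab, mul_assoc]
    rw [this]
    simpa using tmul_mem (V.ρ_mem f hv) (W.ρ_mem f hw)

/-- The components of the unit object: `k` in degree `1` and `0` in all other degrees. -/
def unitGrading (k : Type u) [Field k] (G : Type v) [Group G] (g : G) : Submodule k k where
  carrier := {c | g ≠ 1 → c = 0}
  add_mem' ha hb hg := by rw [ha hg, hb hg, add_zero]
  zero_mem' _ := rfl
  smul_mem' c x hx hg := by rw [hx hg, smul_zero]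

theorem mem_unitGrading_one (c : k) : c ∈ unitGrading k G 1 := fun h => absurd rfl h

theorem unitGrading_one : unitGrading k G 1 = ⊤ :=
  eq_top_iff.2 fun c _ => mem_unitGrading_one c

theorem eq_zero_of_mem_unitGrading {g : G} (hg : g ≠ 1) {c : k} (hc : c ∈ unitGrading k G g) :
    c = 0 := hc hg

/-- The unit object: the ground field in degree `1` with the trivial action. -/
abbrev unit (k : Type u) [Field k] (G : Type v) [Group G] : DrinfeldCentre k G where
  carrier := k
  ρ := Representation.trivial k G k
  grading := unitGrading k G
  indep := by
    classical
    refine iSupIndep_of_proj (fun g => if g = 1 then LinearMap.id else 0) ?_ ?_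
    · intro g m hm
      by_cases hg : g = 1
      · simp [hg]
      · simp [hg, eq_zero_of_mem_unitGrading hg hm]
    · intro g h hne m hm
      by_cases hg : g = 1
      · simp [hg, eq_zero_of_mem_unitGrading (hg ▸ hne) hm]
      · simp [hg]
  iSup_eq_top := eq_top_iff.2 (unitGrading_one.symm.le.trans (le_iSup (unitGrading k G) 1))
  compatible := by
    refine compatible_of_le (Representation.trivial k G k) (fun f g m hm => ?_)
    intro h
    rw [Representation.trivial_apply]
    exact hm fun hg => h (by simp [hg])

theorem tensor_mem_of_tmul {V W : DrinfeldCentre k G} {M : Type*} [AddCommGroup M] [Module k M]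
    (φ : V ⊗[k] W →ₗ[k] M) (A : G → Submodule k M)
    (h : ∀ a b, ∀ v ∈ V.grading a, ∀ w ∈ W.grading b, φ (v ⊗ₜ w) ∈ A (a * b)) (g : G)
    (x : V ⊗[k] W) (hx : x ∈ tensorGrading V W g) : φ x ∈ A g := by
  suffices tensorGrading V W g ≤ (A g).comap φ from this hx
  refine tensorGrading_le fun a b hab v hv w hw => ?_
  subst hab
  exact h a b v hv w hw

/-- The tensor product of morphisms. -/
@[simps]
def tensorMap {V V' W W' : DrinfeldCentre k G} (f : V ⟶ V') (g : W ⟶ W') :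
    tensorObj V W ⟶ tensorObj V' W' where
  hom := TensorProduct.map f.hom g.hom
  map_mem := tensor_mem_of_tmul _ _ fun a b v hv w hw => by
    simpa using tmul_mem (f.map_mem a v hv) (g.map_mem b w hw)
  map_ρ a x := by
    induction x using TensorProduct.induction_on with
    | zero => simp
    | tmul v w => simp [f.map_ρ, g.map_ρ]
    | add x y hx hy => simp only [map_add, hx, hy]

/-- The associativity constraint is that of vector spaces. -/
def assocIso (U V W : DrinfeldCentre k G) :
    tensorObj (tensorObj U V) W ≅ tensorObj U (tensorObj V W) :=
  isoMk (TensorProduct.assoc k U V W)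
    (tensor_mem_of_tmul (V := tensorObj U V) (TensorProduct.assoc k U V W).toLinearMap _
      fun a b x hx w hw => tensor_mem_of_tmul
        ((TensorProduct.assoc k U V W).toLinearMap ∘ₗ
          (TensorProduct.mk k (U ⊗[k] V) W).flip w)
        (fun a => (tensorObj U (tensorObj V W)).grading (a * b))
        (fun c d u hu v hv => by
          simpa [mul_assoc] using tmul_mem (W := tensorObj V W) hu (tmul_mem hv hw)) a x hx)
    (fun a x => by
      have : (TensorProduct.assoc k U V W).toLinearMap ∘ₗ ((U.ρ.tprod V.ρ).tprod W.ρ) a =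
          (U.ρ.tprod (V.ρ.tprod W.ρ)) a ∘ₗ (TensorProduct.assoc k U V W).toLinearMap :=
        TensorProduct.ext_threefold fun _ _ _ => by simp
      exact LinearMap.congr_fun this x)

/-- The left unit constraint is that of vector spaces. -/
def leftUnitIso (V : DrinfeldCentre k G) : tensorObj (unit k G) V ≅ V :=
  isoMk (TensorProduct.lid k V)
    (tensor_mem_of_tmul (V := unit k G) (TensorProduct.lid k V).toLinearMap _
      fun a b c hc v hv => by
        by_cases ha : a = 1
        · subst ha
          simpa using Submodule.smul_mem _ (c : k) hv
        · rw [eq_zero_of_mem_unitGrading ha hc]; simp)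
    (fun a x => by
      have : (TensorProduct.lid k V).toLinearMap ∘ₗ ((unit k G).ρ.tprod V.ρ) a =
          V.ρ a ∘ₗ (TensorProduct.lid k V).toLinearMap :=
        TensorProduct.ext' fun c v => by simp
      exact LinearMap.congr_fun this x)

/-- The right unit constraint is that of vector spaces. -/
def rightUnitIso (V : DrinfeldCentre k G) : tensorObj V (unit k G) ≅ V :=
  isoMk (TensorProduct.rid k V)
    (tensor_mem_of_tmul (W := unit k G) (TensorProduct.rid k V).toLinearMap _
      fun a b v hv c hc => by
        by_cases hb : b = 1
        · subst hb
          simpa using Submodule.smul_mem _ (c : k) hv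
        · rw [eq_zero_of_mem_unitGrading hb hc]; simp)
    (fun a x => by
      have : (TensorProduct.rid k V).toLinearMap ∘ₗ (V.ρ.tprod (unit k G).ρ) a =
          V.ρ a ∘ₗ (TensorProduct.rid k V).toLinearMap :=
        TensorProduct.ext' fun c v => by simp
      exact LinearMap.congr_fun this x)

instance : MonoidalCategoryStruct (DrinfeldCentre k G) where
  tensorObj := tensorObj
  tensorHom := tensorMap
  whiskerLeft V _ _ f := tensorMap (𝟙 V) f
  whiskerRight f V := tensorMap f (𝟙 V)
  tensorUnit := unit k G
  associator := assocIso
  leftUnitor := leftUnitIso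
  rightUnitor := rightUnitIso

instance : MonoidalCategory (DrinfeldCentre k G) :=
  MonoidalCategory.ofTensorHom
    (id_tensorHom_id := fun _ _ => hom_ext TensorProduct.map_id)
    (id_tensorHom := fun _ _ _ _ => rfl)
    (tensorHom_id := fun _ _ => rfl)
    (tensorHom_comp_tensorHom := fun f₁ f₂ g₁ g₂ =>
      hom_ext (TensorProduct.map_comp g₁.hom g₂.hom f₁.hom f₂.hom).symm)
    (associator_naturality := fun _ _ _ =>
      hom_ext (TensorProduct.ext_threefold fun _ _ _ => rfl))
    (leftUnitor_naturality := fun f =>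
      hom_ext (TensorProduct.ext' fun c v => (f.hom.map_smul c v).symm))
    (rightUnitor_naturality := fun f =>
      hom_ext (TensorProduct.ext' fun v c => (f.hom.map_smul c v).symm))
    (pentagon := fun _ _ _ _ =>
      hom_ext (TensorProduct.ext_fourfold fun _ _ _ _ => rfl))
    (triangle := fun _ _ =>
      hom_ext (TensorProduct.ext_threefold fun v c w => (TensorProduct.smul_tmul c v w).symm))

/-! #### The braiding -/

theorem tensor_ext_left {V W : DrinfeldCentre k G} {M : Type*} [AddCommGroup M] [Module k M]
    {φ ψ : V ⊗[k] W →ₗ[k] M}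
    (h : ∀ a, ∀ v ∈ V.grading a, ∀ w, φ (v ⊗ₜ w) = ψ (v ⊗ₜ w)) : φ = ψ := by
  refine TensorProduct.ext (V.linearMap_ext fun a v hv => ?_)
  ext w
  exact h a v hv w

theorem tensor_ext_right {V W : DrinfeldCentre k G} {M : Type*} [AddCommGroup M] [Module k M]
    {φ ψ : W ⊗[k] V →ₗ[k] M}
    (h : ∀ a, ∀ v ∈ V.grading a, ∀ w, φ (w ⊗ₜ v) = ψ (w ⊗ₜ v)) : φ = ψ := by
  refine TensorProduct.ext (LinearMap.ext fun w => V.linearMap_ext fun a v hv => ?_)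
  exact h a v hv w

/-- The linear map `v ⊗ w ↦ a(w) ⊗ v` for `v ∈ V_a`. -/
def braidMap (V W : DrinfeldCentre k G) : V ⊗[k] W →ₗ[k] W ⊗[k] V :=
  TensorProduct.lift <| V.lift fun a =>
    (LinearMap.lcomp k (W ⊗[k] V) (W.ρ a) ∘ₗ (TensorProduct.mk k W V).flip) ∘ₗ
      (V.grading a).subtype

/-- The linear map `w ⊗ v ↦ v ⊗ a⁻¹(w)` for `v ∈ V_a`. -/
def braidInv (V W : DrinfeldCentre k G) : W ⊗[k] V →ₗ[k] V ⊗[k] W :=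
  TensorProduct.lift <| LinearMap.flip <| V.lift fun a =>
    (LinearMap.lcomp k (V ⊗[k] W) (W.ρ a⁻¹) ∘ₗ TensorProduct.mk k V W) ∘ₗ
      (V.grading a).subtype

theorem braidMap_tmul (V W : DrinfeldCentre k G) {a : G} {v : V} (hv : v ∈ V.grading a) (w : W) :
    braidMap V W (v ⊗ₜ w) = W.ρ a w ⊗ₜ v := by
  simp [braidMap, V.lift_apply _ hv]

theorem braidInv_tmul (V W : DrinfeldCentre k G) {a : G} {v : V} (hv : v ∈ V.grading a) (w : W) :
    braidInv V W (w ⊗ₜ v) = v ⊗ₜ W.ρ a⁻¹ w := by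
  simp [braidInv, V.lift_apply _ hv]

/-- The braiding `c(v ⊗ w) = a(w) ⊗ v` for `v ∈ V_a`. -/
def braidIso (V W : DrinfeldCentre k G) : tensorObj V W ≅ tensorObj W V :=
  isoMk
    (LinearEquiv.ofLinearMap (braidMap V W) (braidInv V W)
      (tensor_ext_right fun a v hv w => by simp [braidInv_tmul V W hv, braidMap_tmul V W hv])
      (tensor_ext_left fun a v hv w => by simp [braidInv_tmul V W hv, braidMap_tmul V W hv]))
    (tensor_mem_of_tmul (braidMap V W) _ fun a b v hv w hw => by
      rw [braidMap_tmul V W hv]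
      simpa using tmul_mem (W.ρ_mem a hw) hv)
    (fun g x => by
      have : braidMap V W ∘ₗ (V.ρ.tprod W.ρ) g = (W.ρ.tprod V.ρ) g ∘ₗ braidMap V W := by
        refine tensor_ext_left fun a v hv w => ?_
        simp [braidMap_tmul V W hv, braidMap_tmul V W (V.ρ_mem g hv)]
      exact LinearMap.congr_fun this x)

instance : BraidedCategory (DrinfeldCentre k G) where
  braiding := braidIso
  braiding_naturality_right U V W f := by
    refine hom_ext (tensor_ext_left fun a u hu v => ?_)
    change braidMap U W (u ⊗ₜ f.hom v) =
      TensorProduct.map f.hom LinearMap.id (braidMap U V (u ⊗ₜ v))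
    simp [braidMap_tmul _ _ hu, f.map_ρ]
  braiding_naturality_left {U V} f W := by
    refine hom_ext (tensor_ext_left fun a u hu w => ?_)
    change braidMap V W (f.hom u ⊗ₜ w) =
      TensorProduct.map LinearMap.id f.hom (braidMap U W (u ⊗ₜ w))
    simp [braidMap_tmul _ _ hu, braidMap_tmul _ _ (f.map_mem a u hu)]
  hexagon_forward U V W := by
    refine hom_ext (TensorProduct.ext (tensor_ext_left fun a u hu v => LinearMap.ext fun w => ?_))
    change TensorProduct.assoc k V W U (braidMap U (tensorObj V W) (u ⊗ₜ (v ⊗ₜ w))) =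
      TensorProduct.map LinearMap.id (braidMap U W) (TensorProduct.assoc k V U W
        (TensorProduct.map (braidMap U V) LinearMap.id ((u ⊗ₜ v) ⊗ₜ w)))
    rw [braidMap_tmul U (tensorObj V W) hu]
    simp [braidMap_tmul _ _ hu]
  hexagon_reverse U V W := by
    refine hom_ext (tensor_ext_left fun a u hu => ?_)
    intro x
    induction x using TensorProduct.induction_on with
    | zero => simp
    | add x y hx hy => simp only [TensorProduct.tmul_add, map_add, hx, hy]
    | tmul v w =>
      induction v using V.induction_grading with
      | zero => simp
      | plus x y hx hy =>
        simp only [TensorProduct.tmul_add, TensorProduct.add_tmul, map_add, hx, hy]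
      | hom b v hv =>
        change (TensorProduct.assoc k W U V).symm
            (braidMap (tensorObj U V) W ((u ⊗ₜ v) ⊗ₜ w)) =
          TensorProduct.map (braidMap U W) LinearMap.id ((TensorProduct.assoc k U W V).symm
            (TensorProduct.map LinearMap.id (braidMap V W) (u ⊗ₜ (v ⊗ₜ w))))
        rw [braidMap_tmul (tensorObj U V) W (tmul_mem hu hv)]
        simp [braidMap_tmul _ _ hu, braidMap_tmul _ _ hv]

/-! #### Duals -/

/-- The components of the dual: `(V*)_g = (V_{g⁻¹})*`, i.e. the linear forms on `V` vanishing on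
all components other than `V_{g⁻¹}`. -/
def dualGrading (V : DrinfeldCentre k G) (g : G) : Submodule k (Module.Dual k V) where
  carrier := {l | ∀ h, h ≠ g⁻¹ → ∀ v ∈ V.grading h, l v = 0}
  add_mem' hl hl' h hh v hv := by simp [hl h hh v hv, hl' h hh v hv]
  zero_mem' _ _ _ _ := rfl
  smul_mem' c l hl h hh v hv := by simp [hl h hh v hv]

theorem comp_proj_mem (V : DrinfeldCentre k G) (g : G) (l : Module.Dual k V) :
    l ∘ₗ V.proj g ∈ dualGrading V g⁻¹ := by
  intro h hh v hv
  rw [inv_inv] at hh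
  simp [V.proj_ne hh hv]

/-- The dual object, with the contragredient action `(f l)(v) = l(f⁻¹ v)`. -/
abbrev dual [Finite G] (V : DrinfeldCentre k G) : DrinfeldCentre k G where
  carrier := Module.Dual k V
  ρ := V.ρ.dual
  grading := dualGrading V
  indep := by
    refine iSupIndep_of_proj (fun g => LinearMap.lcomp k k (V.proj g⁻¹)) (fun g l hl => ?_)
      (fun g h hne l hl => ?_)
    · refine V.linearMap_ext fun a v hv => ?_
      by_cases ha : a = g⁻¹
      · simp [V.proj_same (ha ▸ hv)]
      · simp [V.proj_ne ha hv, hl a ha v hv]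
    · refine V.linearMap_ext fun a v hv => ?_
      by_cases ha : a = g⁻¹
      · have : a ≠ h⁻¹ := fun e => hne (inv_injective (e.symm.trans ha))
        simp [V.proj_same (ha ▸ hv), hl a this v hv]
      · simp [V.proj_ne ha hv]
  iSup_eq_top := by
    have := Fintype.ofFinite G
    refine eq_top_iff.2 fun l _ => ?_
    have hl : l = ∑ g, l ∘ₗ V.proj g := by
      ext v
      conv_lhs => rw [← V.sum_proj v]
      simp
    rw [hl]
    exact Submodule.sum_mem _ fun g _ => Submodule.mem_iSup_of_mem g⁻¹ (V.comp_proj_mem g l)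
  compatible := by
    refine compatible_of_le V.ρ.dual fun f g l hl h hh v hv => ?_
    rw [Representation.dual_apply]
    refine hl (f⁻¹ * h * f⁻¹⁻¹) (fun e => hh ?_) _ (V.ρ_mem f⁻¹ hv)
    have : h = f * (f⁻¹ * h * f⁻¹⁻¹) * f⁻¹ := by group
    rw [this, e]
    group

/-- The evaluation `V* ⊗ V ⟶ 1`, `l ⊗ v ↦ l(v)`. -/
def ev [Finite G] (V : DrinfeldCentre k G) : tensorObj (dual V) V ⟶ unit k G where
  hom := contractLeft k V
  map_mem := tensor_mem_of_tmul (V := dual V) (contractLeft k V) _ fun a b l hl v hv hab =>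
    hl b (fun e => hab (by simp [e])) v hv
  map_ρ g x := by
    have : contractLeft k V ∘ₗ (V.ρ.dual.tprod V.ρ) g = contractLeft k V :=
      TensorProduct.ext' fun l v => by
        simp [Representation.dual_apply, Module.Dual.transpose_apply]
    exact LinearMap.congr_fun this x

theorem coevaluation_aux {M : Type*} [AddCommGroup M] [Module k M] [Module.Finite k M]
    (φ ψ : M →ₗ[k] M) :
    dualTensorHom k M M (TensorProduct.comm k M (Module.Dual k M)
      (TensorProduct.map φ (Module.Dual.transpose ψ) (coevaluation k M 1))) = φ ∘ₗ ψ := by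
  ext m
  simp only [coevaluation_apply_one, map_sum, TensorProduct.map_tmul, TensorProduct.comm_tmul,
    LinearMap.sum_apply, dualTensorHom_apply, Module.Dual.transpose_apply, LinearMap.comp_apply]
  conv_rhs => rw [← (Module.Basis.ofVectorSpace k M).sum_repr (ψ m)]
  simp

theorem eq_of_dualTensorHom_comm {M : Type*} [AddCommGroup M] [Module k M] [Module.Finite k M]
    {x y : M ⊗[k] Module.Dual k M}
    (h : dualTensorHom k M M (TensorProduct.comm k M (Module.Dual k M) x) =
      dualTensorHom k M M (TensorProduct.comm k M (Module.Dual k M) y)) : x = y :=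
  (TensorProduct.comm k M (Module.Dual k M)).injective
    ((dualTensorHomEquiv k M M).injective h)

theorem coevaluation_mem [Finite G] (V : DrinfeldCentre k G) :
    coevaluation k V 1 ∈ tensorGrading V (dual V) 1 := by
  have := Fintype.ofFinite G
  have key : coevaluation k V 1 = ∑ a : G, TensorProduct.map (V.proj a)
      (Module.Dual.transpose (V.proj a)) (coevaluation k V 1) := by
    apply eq_of_dualTensorHom_comm
    have h1 := coevaluation_aux (k := k) (LinearMap.id : V →ₗ[k] V) LinearMap.id
    have h2 : Module.Dual.transpose (R := k) (LinearMap.id : V →ₗ[k] V) = LinearMap.id := rfl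
    rw [h2, TensorProduct.map_id, LinearMap.id_apply] at h1
    rw [h1, map_sum, map_sum]
    simp only [coevaluation_aux]
    ext v
    conv_lhs => rw [LinearMap.id_comp, LinearMap.id_apply, ← V.sum_proj v]
    simp [V.proj_same (V.proj_mem _ v)]
  rw [key]
  refine Submodule.sum_mem _ fun a _ => ?_
  generalize coevaluation k V 1 = x
  induction x using TensorProduct.induction_on with
  | zero => simp
  | add x y hx hy => rw [map_add]; exact add_mem hx hy
  | tmul v l =>
    have := tmul_mem (W := dual V) (V.proj_mem a v) (V.comp_proj_mem a l)
    rw [mul_inv_cancel] at this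
    exact this

/-- The coevaluation `1 ⟶ V ⊗ V*`. -/
def coev [Finite G] (V : DrinfeldCentre k G) : unit k G ⟶ tensorObj V (dual V) where
  hom := coevaluation k V
  map_mem g c hc := by
    by_cases hg : g = 1
    · subst hg
      have : coevaluation k V c = c • coevaluation k V 1 := by
        rw [← map_smul, smul_eq_mul, mul_one]
      rw [this]
      exact Submodule.smul_mem _ _ V.coevaluation_mem
    · rw [eq_zero_of_mem_unitGrading hg hc, map_zero]
      exact zero_mem _
  map_ρ g c := by
    have : coevaluation k V = (V.ρ.tprod V.ρ.dual) g ∘ₗ coevaluation k V := by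
      refine LinearMap.ext_ring (eq_of_dualTensorHom_comm ?_)
      have h1 := coevaluation_aux (k := k) (LinearMap.id : V →ₗ[k] V) LinearMap.id
      have h2 : Module.Dual.transpose (R := k) (LinearMap.id : V →ₗ[k] V) = LinearMap.id := rfl
      rw [h2, TensorProduct.map_id, LinearMap.id_apply] at h1
      rw [h1]
      refine Eq.trans ?_ (coevaluation_aux (V.ρ g) (V.ρ g⁻¹)).symm
      ext v
      simp
    exact LinearMap.congr_fun this c

instance [Finite G] (V : DrinfeldCentre k G) : ExactPairing V (dual V) where
  coevaluation' := coev V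
  evaluation' := ev V
  coevaluation_evaluation' := hom_ext (contractLeft_assoc_coevaluation k V)
  evaluation_coevaluation' := hom_ext (contractLeft_assoc_coevaluation' k V)

instance [Finite G] : RightRigidCategory (DrinfeldCentre k G) where
  rightDual V := { rightDual := dual V }

end

end DrinfeldCentre

/-! ### Computing in the Mathieu group -/

namespace MathieuM11

/-! The group is sharply transitive on ordered quadruples of points: coset representatives along the
stabiliser chain of `0, 1, 2, 3` give 11 · 10 · 9 · 8 = 7920 distinct products `elt p`, and this set
contains `1` and is stable under left multiplication by the generators. The stabiliser of `0` is
thereby an explicit list of 720 permutations, and the facts special to the group are finite checks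
on that list.

If `x` conjugates `rot` to `rot ^ n`, then `x` is an affine map of the residues modulo 11 with slope
`n`. The list shows that only the squares modulo 11 occur as slopes, and all of them do, since
`triple` lies in the group. So the normaliser of a Sylow 11-subgroup has order 11 · 5 and, as -1 is
not a square modulo 11, no element of order 11 is conjugate to its inverse.

An automorphism, after an inner correction, sends `r` to `r` or `r⁻¹` and `q` to an element fixing
`0`. One relation between the generators excludes `r⁻¹` and forces the image of `q` to be a
conjugate of `q` under a power of `r`; hence every automorphism is inner (`exists_conj_eq_mulAut`).
An inner class-inverting automorphism would make `r` conjugate to `r⁻¹`.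

Characters separate conjugacy classes (`Representation.isConj_of_trace_eq`), and a complex character
takes conjugate values at `g` and `g⁻¹`; so some irreducible character is not real at `r`.

For the centre of any finite group, let `O` be the algebra of functions in degree 1, which is
self-dual. If `F` is braided and dualising, then `F O` is a commutative algebra in degree 1; a
character of it gives an algebra map to `O`, which is an isomorphism because `O` has no proper
nonzero invariant ideal. The algebra endomorphisms of `O` are the left translations by `G`, so `F`
induces an automorphism `φ`. Through `Hom(O, V) ≃ V`, the functor carries the action of `h` on `V`
to that of `φ h` on `V*`. Equality of traces for all `V` gives that `h` is conjugate to `(φ h)⁻¹`,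
i.e. `φ` is class-inverting, which is impossible for this group. -/

/-- The generator of order eleven. -/
def rot : Equiv.Perm (Fin 11) := c[0, 1, 2, 3, 4, 5, 6, 7, 8, 9, 10]

/-- The generator of order four. -/
def quad : Equiv.Perm (Fin 11) := c[2, 6, 10, 7] * c[3, 9, 4, 5]

/-- The digit of index `i` of `l` in base `16`. -/
@[irreducible]
def get (l i : ℕ) : ℕ := l / 16 ^ i % 16

/-- The number with the given digits in base `16`. -/
def pack (l : List ℕ) : ℕ := l.foldr (fun d n => d + 16 * n) 0

/-- The number whose digits in base `16` are the values of `f`. -/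
@[irreducible]
def packFun (f : ℕ → ℕ) : ℕ :=
  f 0 + 16 * (f 1 + 16 * (f 2 + 16 * (f 3 + 16 * (f 4 + 16 * (f 5 + 16 * (f 6 + 16 * (f 7 +
    16 * (f 8 + 16 * (f 9 + 16 * f 10)))))))))

/-- A permutation of eleven points as the number whose digits in base `16` are its values. -/
@[irreducible]
def code (x : Equiv.Perm (Fin 11)) : ℕ := packFun fun i => x (Fin.ofNat 11 i)

/-- Composition of permutations given by their codes. -/
@[irreducible]
def comp (l m : ℕ) : ℕ := packFun fun i => get l (get m i)

/-! ### Permutations as numbers in base 16. -/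

theorem get_add {d : ℕ} (hd : d < 16) (n i : ℕ) :
    get (d + 16 * n) i = if i = 0 then d else get n (i - 1) := by
  unfold get
  rcases i with - | i
  · simp [Nat.mod_eq_of_lt hd]
  · rw [pow_succ', ← Nat.div_div_eq_div_mul, Nat.add_mul_div_left _ _ (by norm_num),
      Nat.div_eq_of_lt hd]
    simp

theorem get_packFun {f : ℕ → ℕ} (hf : ∀ i, f i < 16) {i : ℕ} (hi : i < 11) :
    get (packFun f) i = f i := by
  rw [packFun, ← add_zero (f 10), ← mul_zero 16]
  interval_cases i <;> simp only [get_add (hf _)] <;> rfl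

theorem packFun_congr {f g : ℕ → ℕ} (h : ∀ i : Fin 11, f i = g i) : packFun f = packFun g := by
  simp only [packFun, show f 0 = g 0 from h 0, show f 1 = g 1 from h 1, show f 2 = g 2 from h 2,
    show f 3 = g 3 from h 3, show f 4 = g 4 from h 4, show f 5 = g 5 from h 5,
    show f 6 = g 6 from h 6, show f 7 = g 7 from h 7, show f 8 = g 8 from h 8,
    show f 9 = g 9 from h 9, show f 10 = g 10 from h 10]

theorem get_code (x : Equiv.Perm (Fin 11)) (i : Fin 11) : get (code x) i = x i := by
  rw [code, get_packFun (fun i => by omega) i.2]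
  simp

theorem code_injective : Function.Injective code := by
  intro x y h
  ext i
  rw [← get_code x, ← get_code y, h]

/-- Turns products of permutations into arithmetic of natural numbers, so that the large finite
checks below become numerical evaluations. -/
theorem code_mul (x y : Equiv.Perm (Fin 11)) : code (x * y) = comp (code x) (code y) := by
  rw [code, comp]
  refine packFun_congr fun i => ?_
  rw [get_code, get_code]
  simp

/-- The word `∏ rot ^ n * quad` in the generators. -/
def word (l : List ℕ) : Equiv.Perm (Fin 11) := (l.map fun n => rot ^ n * quad).prod

/-- The code of `rot ^ n`. -/
def rotCode (n : ℕ) : ℕ := packFun fun i => (i + n) % 11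

/-- The code of `quad`. -/
def quadCode : ℕ := pack [0, 1, 6, 9, 5, 3, 10, 2, 8, 4, 7]

/-- The code of a word. -/
def wordCode (l : List ℕ) : ℕ :=
  l.foldr (fun n c => comp (rotCode n) (comp quadCode c)) (rotCode 0)

theorem rot_apply (i : Fin 11) : rot i = i + 1 := by revert i; decide +kernel

theorem rot_pow_apply (n : ℕ) (i : Fin 11) : (rot ^ n) i = i + Fin.ofNat 11 n := by
  induction n with
  | zero => simp
  | succ n ih =>
    rw [pow_succ', Equiv.Perm.mul_apply, ih, rot_apply]
    ext
    simp [Fin.val_add, add_assoc]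

theorem code_rot_pow (n : ℕ) : code (rot ^ n) = rotCode n := by
  rw [code, rotCode]
  refine packFun_congr fun i => ?_
  simp [rot_pow_apply, Fin.val_add]

theorem code_quad : code quad = quadCode := by decide +kernel

theorem code_word (l : List ℕ) : code (word l) = wordCode l := by
  induction l with
  | nil => exact code_rot_pow 0
  | cons n l ih =>
    rw [word, List.map_cons, List.prod_cons, mul_assoc, code_mul, code_mul, code_rot_pow,
      code_quad, ← word, ih]
    rfl

theorem rot_mem : rot ∈ MathieuM11 := Subgroup.subset_closure (by simp [rot])

theorem quad_mem : quad ∈ MathieuM11 := Subgroup.subset_closure (by simp [quad])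

theorem word_mem (l : List ℕ) : word l ∈ MathieuM11 := by
  refine Subgroup.list_prod_mem _ fun x hx => ?_
  obtain ⟨n, -, rfl⟩ := List.mem_map.1 hx
  exact mul_mem (pow_mem rot_mem n) quad_mem

/-- Words for elements fixing `0` and mapping `1` to `j + 1`. -/
def words₁ : Fin 10 → List ℕ :=
  ![[], [0, 2, 3], [1, 6], [4, 10], [10, 1], [9, 7], [2, 3], [1, 10, 10], [6, 4], [0, 9, 7]]

/-- Words for elements fixing `0`, `1` and mapping `2` to `j + 2`. -/
def words₂ : Fin 9 → List ℕ :=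
  ![[], [1, 5, 1], [3, 6, 7], [2, 4, 6], [0], [0, 0, 0], [2, 6, 2, 2], [8, 9, 10], [0, 0]]

/-- Words for elements fixing `0`, `1`, `2` and mapping `3` to `j + 3`. -/
def words₃ : Fin 8 → List ℕ :=
  ![[], [9, 9, 0, 5], [10, 10, 7], [9, 2, 4], [10, 3, 1, 7], [6, 4, 5, 2], [6, 6, 5, 3],
    [4, 5, 4, 0]]

/-- The values of the elements given by `words₁`. -/
def codes₁ : List ℕ :=
  [pack [0, 1, 2, 3, 4, 5, 6, 7, 8, 9, 10], pack [0, 2, 10, 9, 7, 1, 8, 3, 6, 5, 4],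
    pack [0, 3, 2, 6, 1, 5, 4, 9, 10, 8, 7], pack [0, 4, 7, 1, 9, 10, 8, 5, 6, 2, 3],
    pack [0, 5, 1, 6, 9, 4, 10, 8, 3, 2, 7], pack [0, 6, 4, 1, 10, 5, 8, 2, 3, 9, 7],
    pack [0, 7, 6, 3, 10, 1, 8, 5, 2, 4, 9], pack [0, 8, 7, 3, 6, 4, 10, 1, 2, 9, 5],
    pack [0, 9, 2, 1, 10, 8, 4, 5, 7, 3, 6], pack [0, 10, 5, 1, 7, 3, 8, 6, 9, 4, 2]]

/-- The inverses of `codes₁`. -/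
def invCodes₁ : List ℕ :=
  [pack [0, 1, 2, 3, 4, 5, 6, 7, 8, 9, 10], pack [0, 5, 1, 7, 10, 9, 8, 4, 6, 3, 2],
    pack [0, 4, 2, 1, 6, 5, 3, 10, 9, 7, 8], pack [0, 3, 9, 10, 1, 7, 8, 2, 6, 4, 5],
    pack [0, 2, 9, 8, 5, 1, 3, 10, 7, 4, 6], pack [0, 3, 7, 8, 2, 5, 1, 10, 6, 9, 4],
    pack [0, 5, 8, 3, 9, 7, 2, 1, 6, 10, 4], pack [0, 7, 8, 3, 5, 10, 4, 2, 1, 9, 6],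
    pack [0, 3, 2, 9, 6, 7, 10, 8, 5, 1, 4], pack [0, 3, 10, 5, 9, 2, 7, 4, 6, 8, 1]]

/-- The values of the elements given by `words₂`. -/
def codes₂ : List ℕ :=
  [pack [0, 1, 2, 3, 4, 5, 6, 7, 8, 9, 10], pack [0, 1, 3, 2, 6, 8, 4, 10, 5, 9, 7],
    pack [0, 1, 4, 7, 5, 9, 6, 10, 3, 2, 8], pack [0, 1, 5, 6, 7, 10, 4, 3, 8, 2, 9],
    pack [0, 1, 6, 9, 5, 3, 10, 2, 8, 4, 7], pack [0, 1, 7, 5, 9, 4, 2, 10, 8, 3, 6],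
    pack [0, 1, 8, 3, 2, 6, 7, 10, 9, 4, 5], pack [0, 1, 9, 7, 6, 2, 3, 4, 8, 10, 5],
    pack [0, 1, 10, 4, 3, 9, 7, 6, 8, 5, 2]]

/-- The inverses of `codes₂`. -/
def invCodes₂ : List ℕ :=
  [pack [0, 1, 2, 3, 4, 5, 6, 7, 8, 9, 10], pack [0, 1, 3, 2, 6, 8, 4, 10, 5, 9, 7],
    pack [0, 1, 9, 8, 2, 4, 6, 3, 10, 5, 7], pack [0, 1, 9, 7, 6, 2, 3, 4, 8, 10, 5],
    pack [0, 1, 7, 5, 9, 4, 2, 10, 8, 3, 6], pack [0, 1, 6, 9, 5, 3, 10, 2, 8, 4, 7],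
    pack [0, 1, 4, 3, 9, 10, 5, 6, 2, 8, 7], pack [0, 1, 5, 6, 7, 10, 4, 3, 8, 2, 9],
    pack [0, 1, 10, 4, 3, 9, 7, 6, 8, 5, 2]]

/-- The values of the elements given by `words₃`. -/
def codes₃ : List ℕ :=
  [pack [0, 1, 2, 3, 4, 5, 6, 7, 8, 9, 10], pack [0, 1, 2, 4, 9, 8, 10, 3, 6, 7, 5],
    pack [0, 1, 2, 5, 10, 9, 3, 8, 4, 6, 7], pack [0, 1, 2, 6, 8, 3, 9, 10, 7, 5, 4],
    pack [0, 1, 2, 7, 3, 10, 8, 9, 5, 4, 6], pack [0, 1, 2, 8, 5, 7, 4, 6, 9, 10, 3],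
    pack [0, 1, 2, 9, 7, 6, 5, 4, 10, 3, 8], pack [0, 1, 2, 10, 6, 4, 7, 5, 3, 8, 9]]

/-- With its two analogues, this evaluates each representative once from its word: the words show
membership in the group, the literal codes serve in all later checks. -/
theorem wordCode_words₁ : ∀ j, wordCode (words₁ j) = codes₁.getD j 0 := by decide +kernel

theorem wordCode_words₂ : ∀ j, wordCode (words₂ j) = codes₂.getD j 0 := by decide +kernel

theorem wordCode_words₃ : ∀ j, wordCode (words₃ j) = codes₃.getD j 0 := by decide +kernel

/-- The product of coset representatives along the stabiliser chain of `0, 1, 2, 3`. -/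
def elt (p : Fin 11 × Fin 10 × Fin 9 × Fin 8) : Equiv.Perm (Fin 11) :=
  rot ^ (p.1 : ℕ) * (word (words₁ p.2.1) * (word (words₂ p.2.2.1) * word (words₃ p.2.2.2)))

theorem elt_mem (p : Fin 11 × Fin 10 × Fin 9 × Fin 8) : elt p ∈ MathieuM11 :=
  mul_mem (pow_mem rot_mem _) (mul_mem (word_mem _) (mul_mem (word_mem _) (word_mem _)))

/-- The code of the elements of the stabiliser of `0`. -/
def stabCode (i j l : ℕ) : ℕ :=
  comp (codes₁.getD i 0) (comp (codes₂.getD j 0) (codes₃.getD l 0))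

theorem code_elt (p : Fin 11 × Fin 10 × Fin 9 × Fin 8) :
    code (elt p) = comp (rotCode p.1) (stabCode p.2.1 p.2.2.1 p.2.2.2) := by
  simp only [elt, code_mul, code_rot_pow, code_word, wordCode_words₁, wordCode_words₂,
    wordCode_words₃, stabCode]

/-- Decides whether the code `y` is that of some `elt p`. -/
def sift (y : ℕ) : Bool :=
  let i := get y 0
  -- The indices are the images of `0, 1, 2, 3`, each read after removing the earlier factors from
  -- the left. The final comparison with `y` makes a positive answer sound whatever the tables
  -- contain, so truncated subtractions do no harm.
  let z := comp (rotCode (11 - i)) y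
  let j := get z 1 - 1
  let z' := comp (invCodes₁.getD j 0) z
  let l := get z' 2 - 2
  let m := get (invCodes₂.getD l 0) (get z' 3) - 3
  i.blt 11 && j.blt 10 && l.blt 9 && m.blt 8 && (comp (rotCode i) (stabCode j l m)).beq y

theorem exists_elt_of_code {x : Equiv.Perm (Fin 11)} {i j l m : ℕ} (hi : i < 11) (hj : j < 10)
    (hl : l < 9) (hm : m < 8) (h : comp (rotCode i) (stabCode j l m) = code x) :
    ∃ p, x = elt p :=
  ⟨(⟨i, hi⟩, ⟨j, hj⟩, ⟨l, hl⟩, ⟨m, hm⟩), code_injective (h.symm.trans (code_elt (⟨i, hi⟩, ⟨j, hj⟩, ⟨l, hl⟩, ⟨m, hm⟩)).symm)⟩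

theorem exists_elt_of_sift {x : Equiv.Perm (Fin 11)} (h : sift (code x) = true) :
    ∃ p, x = elt p := by
  simp only [sift, Bool.and_eq_true, Nat.blt_eq, Nat.beq_eq] at h
  obtain ⟨⟨⟨⟨h₀, h₁⟩, h₂⟩, h₃⟩, h⟩ := h
  exact exists_elt_of_code h₀ h₁ h₂ h₃ h

/-- Tests a predicate on the codes of the stabiliser of `0`. -/
def checkStab (q : ℕ → Bool) : Bool :=
  (List.range 10).all fun i => (List.range 9).all fun j => (List.range 8).all fun l =>
    q (stabCode i j l)

theorem of_checkStab {q : ℕ → Bool} (h : checkStab q = true) (i : Fin 10) (j : Fin 9)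
    (l : Fin 8) : q (stabCode i j l) = true := by
  simp only [checkStab, List.all_eq_true, List.mem_range] at h
  exact h i i.2 j j.2 l l.2

/-- Decides whether `y` is the code of the product of elements given by `words₂` and `words₃`. -/
def sift₂ (y : ℕ) : Bool :=
  let l := get y 2 - 2
  let m := get (invCodes₂.getD l 0) (get y 3) - 3
  l.blt 9 && m.blt 8 && (comp (codes₂.getD l 0) (codes₃.getD m 0)).beq y

/-- Decides whether `y` is the code of an element given by `words₃`. -/
def sift₃ (y : ℕ) : Bool :=
  let m := get y 3 - 3
  m.blt 8 && (codes₃.getD m 0).beq y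

theorem exists_of_code₂ {x : Equiv.Perm (Fin 11)} {l m : ℕ} (hl : l < 9) (hm : m < 8)
    (h : comp (codes₂.getD l 0) (codes₃.getD m 0) = code x) :
    ∃ l m, x = word (words₂ l) * word (words₃ m) := by
  refine ⟨⟨l, hl⟩, ⟨m, hm⟩, code_injective ?_⟩
  rw [← h, code_mul, code_word, code_word, wordCode_words₂, wordCode_words₃]

theorem exists_of_code₃ {x : Equiv.Perm (Fin 11)} {m : ℕ} (hm : m < 8)
    (h : codes₃.getD m 0 = code x) : ∃ m, x = word (words₃ m) := by
  refine ⟨⟨m, hm⟩, code_injective ?_⟩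
  rw [← h, code_word, wordCode_words₃]

theorem exists_of_sift₂ {x : Equiv.Perm (Fin 11)} (h : sift₂ (code x) = true) :
    ∃ l m, x = word (words₂ l) * word (words₃ m) := by
  simp only [sift₂, Bool.and_eq_true, Nat.blt_eq, Nat.beq_eq] at h
  obtain ⟨⟨h₂, h₃⟩, h⟩ := h
  exact exists_of_code₂ h₂ h₃ h

theorem exists_of_sift₃ {x : Equiv.Perm (Fin 11)} (h : sift₃ (code x) = true) :
    ∃ m, x = word (words₃ m) := by
  simp only [sift₃, Bool.and_eq_true, Nat.blt_eq, Nat.beq_eq] at h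
  obtain ⟨h₃, h⟩ := h
  exact exists_of_code₃ h₃ h

theorem word₃_mul_word₃ (m m' : Fin 8) : ∃ m'', word (words₃ m) * word (words₃ m') =
    word (words₃ m'') := by
  refine exists_of_sift₃ ?_
  rw [code_mul, code_word, code_word, wordCode_words₃, wordCode_words₃]
  revert m m'
  decide +kernel

theorem word₃_mul_word₂ (m : Fin 8) (l : Fin 9) : ∃ l' m', word (words₃ m) * word (words₂ l) =
    word (words₂ l') * word (words₃ m') := by
  refine exists_of_sift₂ ?_
  rw [code_mul, code_word, code_word, wordCode_words₃, wordCode_words₂]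
  revert m l
  decide +kernel

theorem word₂_mul_word₂ (l l' : Fin 9) : ∃ l'' m, word (words₂ l) * word (words₂ l') =
    word (words₂ l'') * word (words₃ m) := by
  refine exists_of_sift₂ ?_
  rw [code_mul, code_word, code_word, wordCode_words₂, wordCode_words₂]
  revert l l'
  decide +kernel

/-- The 72 products are closed under multiplication: move the inner `words₃` factor to the right,
then collect. Three small tables thus replace a table of 72 · 72 products. -/
theorem word₂₃_mul (l : Fin 9) (m : Fin 8) (l' : Fin 9) (m' : Fin 8) : ∃ l'' m'',
    word (words₂ l) * word (words₃ m) * (word (words₂ l') * word (words₃ m')) =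
      word (words₂ l'') * word (words₃ m'') := by
  obtain ⟨l₁, m₁, h₁⟩ := word₃_mul_word₂ m l'
  obtain ⟨l₂, m₂, h₂⟩ := word₂_mul_word₂ l l₁
  obtain ⟨m₃, h₃⟩ := word₃_mul_word₃ m₁ m'
  obtain ⟨m₄, h₄⟩ := word₃_mul_word₃ m₂ m₃
  refine ⟨l₂, m₄, ?_⟩
  rw [← h₄, ← h₃, ← mul_assoc, ← mul_assoc, ← mul_assoc, ← h₂, mul_assoc (word (words₂ l)),
    h₁]
  simp only [mul_assoc]

theorem quad_mul_rot_pow_mul_word₁ (i : Fin 11) (j : Fin 10) :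
    ∃ p, quad * (rot ^ (i : ℕ) * word (words₁ j)) = elt p := by
  refine exists_elt_of_sift ?_
  rw [code_mul, code_mul, code_word, code_quad, code_rot_pow, wordCode_words₁]
  revert i j
  decide +kernel

/-- The left part `quad * rot ^ i * word (words₁ j)` takes only 110 values, each sifted by
computation; what remains on the right is absorbed by `word₂₃_mul`. -/
theorem quad_mul_elt (p : Fin 11 × Fin 10 × Fin 9 × Fin 8) : ∃ p', quad * elt p = elt p' := by
  obtain ⟨i, j, l, m⟩ := p
  obtain ⟨⟨i', j', l', m'⟩, h⟩ := quad_mul_rot_pow_mul_word₁ i j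
  obtain ⟨l'', m'', h'⟩ := word₂₃_mul l' m' l m
  refine ⟨(i', j', l'', m''), ?_⟩
  calc quad * elt (i, j, l, m)
      = quad * (rot ^ (i : ℕ) * word (words₁ j)) * (word (words₂ l) * word (words₃ m)) := by
        simp only [elt, mul_assoc]
    _ = rot ^ (i' : ℕ) * (word (words₁ j') *
          (word (words₂ l') * word (words₃ m') * (word (words₂ l) * word (words₃ m)))) := by
        rw [h]
        simp only [elt, mul_assoc]
    _ = elt (i', j', l'', m'') := by rw [h', elt]

theorem rot_pow_eleven : rot ^ 11 = 1 := by
  ext i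
  rw [rot_pow_apply]
  simp

theorem rot_mul_elt (p : Fin 11 × Fin 10 × Fin 9 × Fin 8) : ∃ p', rot * elt p = elt p' := by
  refine ⟨(p.1 + 1, p.2), ?_⟩
  rw [elt, elt, ← mul_assoc, ← pow_succ', Fin.val_add, Fin.val_one,
    ← pow_eq_pow_mod _ rot_pow_eleven]

theorem exists_eq_elt {x : Equiv.Perm (Fin 11)} (hx : x ∈ MathieuM11) : ∃ p, x = elt p := by
  -- In a finite group the generated subgroup is the generated submonoid, so left multiplication by
  -- the two generators suffices and no inverses are needed.
  rw [MathieuM11, ← Subgroup.mem_toSubmonoid, Subgroup.closure_toSubmonoid_of_finite] at hx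
  induction hx using Submonoid.closure_induction_left with
  | one => exact ⟨(0, 0, 0, 0), by simp [elt, words₁, words₂, words₃, word]⟩
  | mul_left s hs y hy ih =>
    obtain ⟨p, rfl⟩ := ih
    rcases hs with rfl | rfl
    exacts [rot_mul_elt p, quad_mul_elt p]

/-! ### Sharp transitivity on quadruples and the order of the group. -/

theorem word₁_zero (j : Fin 10) : word (words₁ j) 0 = 0 := by
  rw [← Fin.val_inj, ← get_code, code_word, wordCode_words₁]
  revert j
  decide +kernel

theorem word₁_one (j : Fin 10) : (word (words₁ j) 1 : ℕ) = j + 1 := by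
  rw [← get_code, code_word, wordCode_words₁]
  revert j
  decide +kernel

theorem word₂_zero (l : Fin 9) : word (words₂ l) 0 = 0 := by
  rw [← Fin.val_inj, ← get_code, code_word, wordCode_words₂]
  revert l
  decide +kernel

theorem word₂_one (l : Fin 9) : word (words₂ l) 1 = 1 := by
  rw [← Fin.val_inj, ← get_code, code_word, wordCode_words₂]
  revert l
  decide +kernel

theorem word₂_two (l : Fin 9) : (word (words₂ l) 2 : ℕ) = l + 2 := by
  rw [← get_code, code_word, wordCode_words₂]
  revert l
  decide +kernel

theorem word₃_zero (m : Fin 8) : word (words₃ m) 0 = 0 := by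
  rw [← Fin.val_inj, ← get_code, code_word, wordCode_words₃]
  revert m
  decide +kernel

theorem word₃_one (m : Fin 8) : word (words₃ m) 1 = 1 := by
  rw [← Fin.val_inj, ← get_code, code_word, wordCode_words₃]
  revert m
  decide +kernel

theorem word₃_two (m : Fin 8) : word (words₃ m) 2 = 2 := by
  rw [← Fin.val_inj, ← get_code, code_word, wordCode_words₃]
  revert m
  decide +kernel

theorem word₃_three (m : Fin 8) : (word (words₃ m) 3 : ℕ) = m + 3 := by
  rw [← get_code, code_word, wordCode_words₃]
  revert m
  decide +kernel

theorem elt_zero (p : Fin 11 × Fin 10 × Fin 9 × Fin 8) : elt p 0 = p.1 := by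
  simp [elt, word₁_zero, word₂_zero, word₃_zero, rot_pow_apply]

/-- The images of `0, 1, 2, 3` recover the four indices in turn: later factors fix the point in
question, and equal left factors cancel. -/
theorem elt_injective : Function.Injective elt := by
  rintro ⟨i, j, l, m⟩ ⟨i', j', l', m'⟩ h
  obtain rfl : i = i' := by
    have := congr($h 0)
    rwa [elt_zero, elt_zero] at this
  have h₁ := mul_left_cancel h
  obtain rfl : j = j' := by
    have := congr(($h₁ 1 : ℕ))
    simp only [Equiv.Perm.mul_apply, word₃_one, word₂_one, word₁_one] at this
    omega
  have h₂ := mul_left_cancel h₁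
  obtain rfl : l = l' := by
    have := congr(($h₂ 2 : ℕ))
    simp only [Equiv.Perm.mul_apply, word₃_two, word₂_two] at this
    omega
  have h₃ := mul_left_cancel h₂
  obtain rfl : m = m' := by
    have := congr(($h₃ 3 : ℕ))
    simp only [word₃_three] at this
    omega
  rfl

theorem card_eq : Nat.card MathieuM11 = 7920 := by
  have h : Function.Bijective fun p => (⟨elt p, elt_mem p⟩ : MathieuM11) :=
    ⟨fun p q h => elt_injective congr(($h : Equiv.Perm (Fin 11))), fun x => by
      obtain ⟨p, hp⟩ := exists_eq_elt x.2
      exact ⟨p, Subtype.ext hp.symm⟩⟩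
  rw [← Nat.card_eq_of_bijective _ h]
  simp

/-- The elements fixing `0` are those with first index `0`, so 720 evaluations decide a property on
the whole stabiliser. -/
theorem of_checkStab_of_mem {q : ℕ → Bool} (h : checkStab q = true) {x : Equiv.Perm (Fin 11)}
    (hx : x ∈ MathieuM11) (h0 : x 0 = 0) : q (code x) = true := by
  obtain ⟨⟨i, j, l, m⟩, rfl⟩ := exists_eq_elt hx
  obtain rfl : i = 0 := (elt_zero _).symm.trans h0
  have h1 := of_checkStab h j l m
  have h2 : code (elt (0, j, l, m)) = stabCode j l m := by
    simp only [elt, Fin.val_zero, pow_zero, one_mul, code_mul, code_word, wordCode_words₁,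
      wordCode_words₂, wordCode_words₃, stabCode]
  rwa [h2]

/-- The multiplication by `3` modulo `11`. -/
def triple : Equiv.Perm (Fin 11) := word [6, 8, 10]

theorem triple_mem : triple ∈ MathieuM11 := word_mem _

theorem triple_apply (i : Fin 11) : triple i = 3 * i := by
  rw [← Fin.val_inj, ← get_code, triple, code_word]
  revert i
  decide +kernel

/-- The powers of `3` modulo `11`. -/
def squares : List ℕ := [1, 3, 9, 5, 4]

theorem get_one_mem_squares : checkStab (fun c =>
    !((List.range 11).all fun i => (get c i).beq (i * get c 1 % 11)) ||
      squares.contains (get c 1)) = true := by decide +kernel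

/-- An element of `M₁₁` that acts on the residues modulo `11` as a multiplication acts as the
multiplication by a power of `3`. -/
theorem mem_squares_of_apply {x : Equiv.Perm (Fin 11)} (hx : x ∈ MathieuM11)
    (h : ∀ i, x i = i * x 1) : (x 1 : ℕ) ∈ squares := by
  have h1 := of_checkStab_of_mem get_one_mem_squares hx (by simpa using h 0)
  rw [Bool.or_eq_true, Bool.not_eq_true', List.contains_iff_mem, ← Fin.val_one 9, get_code] at h1
  refine h1.resolve_left fun h2 => ?_
  rw [← Bool.not_eq_true, List.all_eq_true] at h2
  refine h2 fun i hi => ?_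
  rw [List.mem_range] at hi
  rw [Nat.beq_eq, show i = ((⟨i, hi⟩ : Fin 11) : ℕ) from rfl, get_code, h, Fin.val_mul]

/-- The permutations fixing `0` that are conjugate to `quad` under the powers of `rot`. -/
def quads : List ℕ :=
  [quadCode, comp (rotCode 10) (comp quadCode (rotCode 1)),
    comp (rotCode 3) (comp quadCode (rotCode 8))]

/-- The value at `p` of the word `r y r⁴ y r³ y r⁹ y`, where `r` is the translation by `n`. -/
def relator (n c p : ℕ) : ℕ :=
  (get c ((get c ((get c ((get c p + 9 * n) % 11) + 3 * n) % 11) + 4 * n) % 11) + n) % 11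

/-- The finite check behind the triviality of the outer automorphism group. Among elements fixing
`0`, the relation with translation by 1 allows only the three listed conjugates of `quad`, one for
each of its fixed points `0, 1, 8`; with translation by 10, i.e. by -1, it has no solution. -/
theorem relator_check : checkStab (fun c =>
    (!((List.range 11).all fun p => (relator 1 c p).beq p) || quads.contains c) &&
      !((List.range 11).all fun p => (relator 10 c p).beq p)) = true := by decide +kernel

end MathieuM11

/-! ### Sylow subgroups and automorphisms of the Mathieu group -/

namespace MathieuM11

/-- The generator of order eleven, as an element of `M₁₁`. -/
def r : MathieuM11 := ⟨rot, rot_mem⟩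

/-- The generator of order four, as an element of `M₁₁`. -/
def q : MathieuM11 := ⟨quad, quad_mem⟩

/-- The multiplication by `3`, as an element of `M₁₁`. -/
def t : MathieuM11 := ⟨triple, triple_mem⟩

theorem coe_r : (r : Equiv.Perm (Fin 11)) = rot := rfl

theorem coe_q : (q : Equiv.Perm (Fin 11)) = quad := rfl

theorem closure_eq_top : Subgroup.closure {r, q} = ⊤ := by
  have h : Subgroup.closure ((↑) ⁻¹' {rot, quad} : Set MathieuM11) = ⊤ :=
    Subgroup.closure_closure_coe_preimage
  rw [← h]
  congr 1
  ext x
  change x = r ∨ x = q ↔ (x : Equiv.Perm (Fin 11)) = rot ∨ (x : Equiv.Perm (Fin 11)) = quad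
  simp only [Subtype.ext_iff, coe_r, coe_q]

theorem mulAut_ext {φ ψ : MulAut MathieuM11} (hr : φ r = ψ r) (hq : φ q = ψ q) : φ = ψ := by
  have h : (φ : MathieuM11 →* MathieuM11) = ψ :=
    MonoidHom.eq_of_eqOn_dense closure_eq_top (by
      rintro x (rfl | rfl)
      exacts [hr, hq])
  exact MulEquiv.ext fun x => DFunLike.congr_fun h x

theorem r_pow_eleven : r ^ 11 = 1 := Subtype.ext rot_pow_eleven

theorem r_ne_one : r ≠ 1 := by
  intro h
  have h0 : rot = 1 := congr(($h : Equiv.Perm (Fin 11)))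
  have h1 := rot_apply 0
  rw [h0] at h1
  simp at h1

instance : Fact (Nat.Prime 11) := ⟨by norm_num⟩

theorem orderOf_r : orderOf r = 11 := orderOf_eq_prime r_pow_eleven r_ne_one

/-- A cyclic subgroup of order eleven, as a Sylow subgroup. -/
def sylowOfOrder (g : MathieuM11) (hg : orderOf g = 11) : Sylow 11 MathieuM11 :=
  Sylow.ofCard (Subgroup.zpowers g) (by
    rw [Nat.card_zpowers, hg, card_eq, show 7920 = 11 * 720 from rfl,
      Nat.factorization_mul (by norm_num) (by norm_num), Finsupp.add_apply,
      Nat.Prime.factorization_self (by norm_num),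
      Nat.factorization_eq_zero_of_not_dvd (by norm_num), add_zero, pow_one])

theorem coe_sylowOfOrder (g : MathieuM11) (hg : orderOf g = 11) :
    (sylowOfOrder g hg : Subgroup MathieuM11) = Subgroup.zpowers g := rfl

theorem triple_mul_rot : triple * rot = rot ^ 3 * triple := by
  refine Equiv.ext fun i => ?_
  rw [Equiv.Perm.mul_apply, Equiv.Perm.mul_apply, triple_apply, triple_apply, rot_apply,
    rot_pow_apply]
  revert i
  decide +kernel

theorem semiconj_t : SemiconjBy t r (r ^ 3) := Subtype.ext triple_mul_rot

theorem semiconj_t_pow (k : ℕ) : SemiconjBy (t ^ k) r (r ^ 3 ^ k) := by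
  induction k with
  | zero => simp
  | succ k ih =>
    rw [pow_succ', pow_succ']
    have := semiconj_t.pow_right (3 ^ k)
    rw [← pow_mul] at this
    exact this.mul_left ih

/-! ### Conjugacy of elements of order eleven. -/

theorem exists_conj_eq_pow {g : MathieuM11} (hg : orderOf g = 11) :
    ∃ c : MathieuM11, ∃ n < 11, n ≠ 0 ∧ c * g * c⁻¹ = r ^ n := by
  obtain ⟨c, hc⟩ := MulAction.exists_smul_eq MathieuM11 (sylowOfOrder g hg)
    (sylowOfOrder r orderOf_r)
  have h1 : MulAut.conj c g ∈ Subgroup.zpowers r := by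
    rw [← coe_sylowOfOrder r orderOf_r, ← hc]
    exact Subgroup.smul_mem_pointwise_smul g (MulAut.conj c) _ (Subgroup.mem_zpowers g)
  rw [MulAut.conj_apply, mem_zpowers_iff_mem_range_orderOf, orderOf_r, Finset.mem_image] at h1
  obtain ⟨n, hn, h1⟩ := h1
  refine ⟨c, n, Finset.mem_range.1 hn, ?_, h1.symm⟩
  rintro rfl
  rw [pow_zero, eq_comm, conj_eq_one_iff] at h1
  rw [h1, orderOf_one] at hg
  norm_num at hg

theorem exists_conj_eq {g : MathieuM11} (hg : orderOf g = 11) :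
    ∃ c : MathieuM11, ∃ n : ℕ, (n = 1 ∨ n = 10) ∧ c * g * c⁻¹ = r ^ n := by
  obtain ⟨c, n, hn, hn0, h⟩ := exists_conj_eq_pow hg
  -- The powers of 3 are the squares modulo 11, a subgroup of index 2 whose other coset contains 10
  -- = -1. Conjugating by powers of `t` moves the exponent within its coset.
  have key : ∀ n < 11, n ≠ 0 → ∃ k < 5, 3 ^ k * n % 11 = 1 ∨ 3 ^ k * n % 11 = 10 := by decide
  obtain ⟨k, -, hk⟩ := key n hn hn0
  refine ⟨t ^ k * c, 3 ^ k * n % 11, hk, ?_⟩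
  rw [← pow_eq_pow_mod _ r_pow_eleven, mul_inv_rev,
    show t ^ k * c * g * (c⁻¹ * (t ^ k)⁻¹) = t ^ k * (c * g * c⁻¹) * (t ^ k)⁻¹ by group, h, pow_mul,
    ((semiconj_t_pow k).pow_right n).eq, mul_inv_cancel_right]

/-- Evaluating `x * rot ^ i = rot ^ (n * i) * x` at `0` shows that `x` is affine with slope `n`. -/
theorem apply_of_semiconjBy {x : Equiv.Perm (Fin 11)} {n : ℕ} (h : SemiconjBy x rot (rot ^ n))
    (i : Fin 11) : x i = x 0 + i * Fin.ofNat 11 n := by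
  have h1 := congr($((h.pow_right i).eq) 0)
  rw [← pow_mul, Equiv.Perm.mul_apply, Equiv.Perm.mul_apply, rot_pow_apply, rot_pow_apply] at h1
  rw [← Fin.val_inj]
  simpa [Fin.val_add, Fin.val_mul, mul_comm n] using congr(($h1 : ℕ))

theorem mod_mem_squares_of_semiconjBy {x : MathieuM11} {n : ℕ} (h : SemiconjBy x r (r ^ n)) :
    n % 11 ∈ squares := by
  have h1 : SemiconjBy (x : Equiv.Perm (Fin 11)) rot (rot ^ n) :=
    congr(($(h.eq) : Equiv.Perm (Fin 11)))
  -- Removing the translation part `x 0` leaves multiplication by `n`, an element fixing `0` to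
  -- which the check on the stabiliser applies.
  have h2 : ∀ i, (rot ^ (11 - (x.1 0 : ℕ)) * x.1) i = i * Fin.ofNat 11 n := by
    intro i
    rw [Equiv.Perm.mul_apply, apply_of_semiconjBy h1 i, rot_pow_apply]
    generalize x.1 0 = a
    generalize Fin.ofNat 11 n = b
    clear * -
    revert i a b
    decide +kernel
  have h3 := mem_squares_of_apply (mul_mem (pow_mem rot_mem (11 - (x.1 0 : ℕ))) x.2)
    (fun i => by rw [h2, h2, one_mul])
  rw [h2, one_mul] at h3
  simpa using h3

theorem not_isConj_r_inv : ¬ IsConj r r⁻¹ := by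
  rintro ⟨c, hc⟩
  have h1 : r⁻¹ = r ^ 10 := by
    rw [inv_eq_iff_mul_eq_one, ← pow_succ', r_pow_eleven]
  rw [h1] at hc
  exact absurd (mod_mem_squares_of_semiconjBy hc) (by decide)

/-- Up to conjugacy `g` is `r` or `r ^ 10 = r⁻¹`, so both cases reduce to `r`, where -1 would have
to be a square modulo 11. -/
theorem not_isConj_inv {g : MathieuM11} (hg : orderOf g = 11) : ¬ IsConj g g⁻¹ := by
  intro h
  obtain ⟨c, n, hn, hc⟩ := exists_conj_eq hg
  have h1 : IsConj g (r ^ n) := isConj_iff.2 ⟨c, hc⟩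
  have h2 : IsConj g⁻¹ (r ^ n)⁻¹ := isConj_iff.2 ⟨c, by rw [← hc]; group⟩
  have h3 : IsConj (r ^ n) (r ^ n)⁻¹ := h1.symm.trans (h.trans h2)
  rcases hn with rfl | rfl
  · rw [pow_one] at h3
    exact not_isConj_r_inv h3
  · have h4 : (r ^ 10)⁻¹ = r := by
      rw [inv_eq_iff_mul_eq_one, ← pow_succ, r_pow_eleven]
    rw [h4] at h3
    rw [inv_eq_iff_eq_inv] at h4
    rw [h4] at h3
    exact not_isConj_r_inv h3.symm

/-! ### The normaliser of a Sylow 11-subgroup. -/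

theorem mul_apply_zero_one (i : Fin 11) (k : Fin 5) :
    (r ^ (i : ℕ) * t ^ (k : ℕ) : MathieuM11).1 0 = i ∧
      (r ^ (i : ℕ) * t ^ (k : ℕ) : MathieuM11).1 1 = i + Fin.ofNat 11 (3 ^ (k : ℕ)) := by
  have h (j : Fin 11) : (triple ^ (k : ℕ)) j = j * Fin.ofNat 11 (3 ^ (k : ℕ)) := by
    generalize (k : ℕ) = m
    induction m with
    | zero => exact (mul_one j).symm
    | succ m ih =>
      rw [pow_succ', Equiv.Perm.mul_apply, ih, triple_apply, ← Fin.val_inj]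
      simp [Fin.val_mul, pow_succ', mul_left_comm]
  refine ⟨?_, ?_⟩ <;>
  · change (rot ^ (i : ℕ)) ((triple ^ (k : ℕ)) _) = _
    rw [h, rot_pow_apply, ← Fin.val_inj]
    simp [Fin.val_add, add_comm]

theorem mem_normalizer_zpowers_r (i k : ℕ) :
    r ^ i * t ^ k ∈ Subgroup.normalizer (Subgroup.zpowers r : Set MathieuM11) := by
  have h : t ∈ Subgroup.normalizer (Subgroup.zpowers r : Set MathieuM11) := by
    refine Subgroup.mem_normalizer_fintype fun x hx => ?_
    obtain ⟨n, rfl⟩ := mem_powers_iff_mem_zpowers.2 hx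
    have h1 := (semiconj_t.pow_right n).eq
    simp only at h1 ⊢
    rw [h1, mul_inv_cancel_right, ← pow_mul]
    exact Subgroup.npow_mem_zpowers r _
  exact mul_mem (pow_mem (Subgroup.le_normalizer (Subgroup.mem_zpowers r)) i) (pow_mem h k)

theorem card_normalizer_zpowers_r :
    Nat.card (Subgroup.normalizer (Subgroup.zpowers r : Set MathieuM11)) = 55 := by
  let f : Fin 11 × Fin 5 → Subgroup.normalizer (Subgroup.zpowers r : Set MathieuM11) :=
    fun p => ⟨r ^ (p.1 : ℕ) * t ^ (p.2 : ℕ), mem_normalizer_zpowers_r _ _⟩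
  have hf : Function.Bijective f := by
    refine ⟨fun p p' h => ?_, fun x => ?_⟩
    · obtain ⟨i, k⟩ := p
      obtain ⟨i', k'⟩ := p'
      have h : r ^ (i : ℕ) * t ^ (k : ℕ) = r ^ (i' : ℕ) * t ^ (k' : ℕ) := congr(($h : MathieuM11))
      have h0 := congr(($h : Equiv.Perm (Fin 11)) 0)
      have h1 := congr(($h : Equiv.Perm (Fin 11)) 1)
      rw [(mul_apply_zero_one _ _).1, (mul_apply_zero_one _ _).1] at h0
      rw [(mul_apply_zero_one _ _).2, (mul_apply_zero_one _ _).2, h0, add_right_inj] at h1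
      subst h0
      refine Prod.ext rfl (?_ : k = k')
      revert h1
      clear * -
      revert k k'
      decide +kernel
    -- A normalising element is an affine map, determined by its value at `0` and its slope. The
    -- slope is a power of 3, so some `r ^ i * t ^ k` has the same data.
    · have h1 : MulAut.conj x.1 r ∈ Subgroup.zpowers r :=
        (Subgroup.mem_normalizer_iff.1 x.2 r).1 (Subgroup.mem_zpowers r)
      rw [mem_zpowers_iff_mem_range_orderOf, orderOf_r, Finset.mem_image] at h1
      obtain ⟨n, hn, h1⟩ := h1
      rw [Finset.mem_range] at hn
      have h2 : SemiconjBy x.1 r (r ^ n) := by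
        rw [SemiconjBy, h1, MulAut.conj_apply, inv_mul_cancel_right]
      have h3 := mod_mem_squares_of_semiconjBy h2
      have key : ∀ n < 11, n % 11 ∈ squares → ∃ k : Fin 5, 3 ^ (k : ℕ) % 11 = n := by decide
      obtain ⟨k, hk⟩ := key n hn h3
      refine ⟨(x.1.1 0, k), Subtype.ext (Subtype.ext (Equiv.ext fun i => ?_))⟩
      have h4 : SemiconjBy x.1.1 rot (rot ^ n) := congr(($(h2.eq) : Equiv.Perm (Fin 11)))
      have h5 : SemiconjBy (r ^ (x.1.1 0 : ℕ) * t ^ (k : ℕ)) r (r ^ n) := by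
        rw [← hk, ← pow_eq_pow_mod _ r_pow_eleven]
        exact ((Commute.refl r).pow_pow _ _).semiconjBy.mul_left (semiconj_t_pow k)
      have h6 : SemiconjBy (r ^ (x.1.1 0 : ℕ) * t ^ (k : ℕ)).1 rot (rot ^ n) :=
        congr(($(h5.eq) : Equiv.Perm (Fin 11)))
      rw [apply_of_semiconjBy h4 i]
      exact (apply_of_semiconjBy h6 i).trans (by rw [(mul_apply_zero_one _ _).1])
  rw [← Nat.card_eq_of_bijective f hf]
  simp

theorem card_sylow_and_normalizer : Nat.card (Sylow 11 MathieuM11) = 144 ∧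
    ∀ P : Sylow 11 MathieuM11, Nat.card
      (Subgroup.normalizer ((P : Subgroup MathieuM11) : Set MathieuM11)) = 55 := by
  have h (P : Sylow 11 MathieuM11) : Nat.card
      (Subgroup.normalizer ((P : Subgroup MathieuM11) : Set MathieuM11)) *
        Nat.card (Sylow 11 MathieuM11) = 7920 := by
    rw [P.card_eq_index_normalizer, ← card_eq]
    exact Subgroup.card_mul_index _
  have h1 := h (sylowOfOrder r orderOf_r)
  rw [coe_sylowOfOrder, card_normalizer_zpowers_r] at h1
  have h2 : Nat.card (Sylow 11 MathieuM11) = 144 := by omega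
  refine ⟨h2, fun P => ?_⟩
  have h3 := h P
  rw [h2] at h3
  omega

/-! ### Rigidity of the generators under automorphisms. -/

theorem relation : r * q * r ^ 4 * q * r ^ 3 * q * r ^ 9 * q = 1 := by
  refine Subtype.ext (code_injective ?_)
  change code (rot * quad * rot ^ 4 * quad * rot ^ 3 * quad * rot ^ 9 * quad) = code (rot ^ 0)
  rw [← pow_one rot]
  simp only [← pow_mul, one_mul, code_mul, code_quad, code_rot_pow]
  decide +kernel

theorem q_pow_four : q ^ 4 = 1 := by
  refine Subtype.ext (code_injective ?_)
  change code (quad ^ 4) = code (rot ^ 0)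
  simp only [pow_succ, pow_zero, one_mul, code_mul, code_quad]
  rw [← pow_zero rot, code_rot_pow]
  decide +kernel

/-- The orbits have lengths 1, 2 or 4, and eleven is odd. -/
theorem exists_fixed_point {x : Equiv.Perm (Fin 11)} (hx : x ^ 4 = 1) : ∃ i, x i = i := by
  by_contra! h
  have h1 := Equiv.Perm.card_compl_support_modEq (p := 2) (n := 2) hx
  have h2 : x.support = Finset.univ := Finset.eq_univ_of_forall fun i => by simpa using h i
  rw [h2] at h1
  exact absurd h1 (by decide)

/-- Translates the group relation into pointwise equations on codes, so that `relator_check`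
applies. The witnesses 0, 10 and 3 for `k` bring the fixed points 0, 1 and 8 of `quad` to 0. -/
theorem exists_eq_of_relation {x : MathieuM11} (hx : x.1 0 = 0) {n : ℕ} (hn : n = 1 ∨ n = 10)
    (h : r ^ n * x * (r ^ n) ^ 4 * x * (r ^ n) ^ 3 * x * (r ^ n) ^ 9 * x = 1) :
    n = 1 ∧ ∃ k, x = r ^ k * q * (r ^ k)⁻¹ := by
  have h1 : ∀ p < 11, relator n (code x) p = p := by
    intro p hp
    have h2 := congr((($h : Equiv.Perm (Fin 11)) ⟨p, hp⟩ : ℕ))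
    change ((rot ^ n * x.1 * (rot ^ n) ^ 4 * x.1 * (rot ^ n) ^ 3 * x.1 * (rot ^ n) ^ 9 * x.1)
      ⟨p, hp⟩ : ℕ) = p at h2
    conv_rhs => rw [← h2]
    have h3 := get_code x.1 ⟨p, hp⟩
    simp only at h3
    have h4 (i : Fin 11) (m : ℕ) : get (code x) ((i + m) % 11) = x.1 (i + Fin.ofNat 11 m) := by
      rw [← get_code]
      simp [Fin.val_add]
    simp only [relator, ← pow_mul, Equiv.Perm.mul_apply, rot_pow_apply, Fin.val_add, h3, h4,
      mul_comm n]
    simp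
  have h2 := of_checkStab_of_mem relator_check x.2 hx
  have h3 : ∀ p ∈ List.range 11, (relator n (code x) p).beq p = true := fun p hp =>
    Nat.beq_eq.symm ▸ h1 p (List.mem_range.1 hp)
  rw [← List.all_eq_true] at h3
  rw [Bool.and_eq_true] at h2
  rcases hn with rfl | rfl
  · have h4 := h2.1
    rw [h3, Bool.not_true, Bool.false_or, List.contains_iff_mem, quads] at h4
    have h5 {k k' : ℕ} (hk : k + k' = 11) :
        code (r ^ k * q * (r ^ k)⁻¹ : MathieuM11) =
          comp (rotCode k) (comp quadCode (rotCode k')) := by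
      have h6 : (r ^ k)⁻¹ = r ^ k' := by
        rw [inv_eq_iff_mul_eq_one, ← pow_add, hk, r_pow_eleven]
      rw [h6, ← code_quad, ← code_rot_pow, ← code_rot_pow, ← code_mul, ← code_mul, mul_assoc]
      rfl
    refine ⟨rfl, ?_⟩
    simp only [List.mem_cons, List.not_mem_nil, or_false] at h4
    rcases h4 with h4 | h4 | h4
    · refine ⟨0, Subtype.ext (code_injective (h4.trans ?_))⟩
      simp [coe_q, code_quad]
    · exact ⟨10, Subtype.ext (code_injective (h4.trans (h5 rfl).symm))⟩
    · exact ⟨3, Subtype.ext (code_injective (h4.trans (h5 rfl).symm))⟩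
  · rw [h3] at h2
    exact absurd h2.2 (by decide)

theorem exists_conj_eq_mulAut (φ : MulAut MathieuM11) : ∃ g, MulAut.conj g = φ := by
  obtain ⟨c, n, hn, hc⟩ := exists_conj_eq (g := φ r)
    (by rw [MulEquiv.orderOf_eq, orderOf_r])
  obtain ⟨i, hi⟩ := exists_fixed_point (x := (MulAut.conj c (φ q)).1) (by
    rw [← Subgroup.coe_pow, ← map_pow, ← map_pow, q_pow_four, map_one, map_one,
      Subgroup.coe_one])
  -- Conjugation by a power of `r` brings the fixed point `i` to `0` without disturbing the image `r
  -- ^ n` of `r`.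
  let ψ := MulAut.conj ((r ^ (i : ℕ))⁻¹ * c) * φ
  have hr : ψ r = r ^ n := by
    change (r ^ (i : ℕ))⁻¹ * c * φ r * ((r ^ (i : ℕ))⁻¹ * c)⁻¹ = r ^ n
    rw [mul_inv_rev, show (r ^ (i : ℕ))⁻¹ * c * φ r * (c⁻¹ * (r ^ (i : ℕ))⁻¹⁻¹) =
      (r ^ (i : ℕ))⁻¹ * (c * φ r * c⁻¹) * r ^ (i : ℕ) by group, hc]
    group
  have hq : (ψ q).1 0 = 0 := by
    have h1 : ψ q = (r ^ (i : ℕ))⁻¹ * MulAut.conj c (φ q) * r ^ (i : ℕ) := by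
      change (r ^ (i : ℕ))⁻¹ * c * φ q * ((r ^ (i : ℕ))⁻¹ * c)⁻¹ =
        (r ^ (i : ℕ))⁻¹ * (c * φ q * c⁻¹) * r ^ (i : ℕ)
      group
    have h2 : (rot ^ (i : ℕ)) 0 = i := by simp [rot_pow_apply]
    rw [h1]
    change (rot ^ (i : ℕ))⁻¹ ((MulAut.conj c (φ q)).1 ((rot ^ (i : ℕ)) 0)) = 0
    rw [h2, hi, Equiv.Perm.inv_eq_iff_eq, h2]
  have h1 := congr(ψ $relation)
  simp only [map_mul, map_pow, hr, map_one] at h1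
  obtain ⟨rfl, k, hk⟩ := exists_eq_of_relation hq hn h1
  have h2 : ψ = MulAut.conj (r ^ k) := by
    refine mulAut_ext ?_ hk
    rw [hr, MulAut.conj_apply]
    group
  refine ⟨((r ^ (i : ℕ))⁻¹ * c)⁻¹ * r ^ k, ?_⟩
  rw [map_mul, map_inv, ← h2, inv_mul_cancel_left]

theorem subsingleton_outerAut : Subsingleton (OuterAut MathieuM11) := by
  rw [OuterAut, QuotientGroup.subsingleton_iff]
  exact MonoidHom.range_eq_top.2 exists_conj_eq_mulAut

theorem not_isClassInverting (φ : MulAut MathieuM11) : ¬ IsClassInverting φ := by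
  intro h
  obtain ⟨g, rfl⟩ := exists_conj_eq_mulAut φ
  obtain ⟨c, hc⟩ := h r
  refine not_isConj_r_inv (isConj_iff.2 ⟨c⁻¹ * g, ?_⟩)
  rw [MulAut.conj_apply] at hc
  rw [mul_inv_rev, inv_inv, show c⁻¹ * g * r * (g⁻¹ * c) = c⁻¹ * (g * r * g⁻¹) * c by group, hc]
  group

end MathieuM11

/-! ### Characters separate conjugacy classes -/

namespace Representation

/-- The action of `G` on functions by right translation. -/
def rightTranslation (k : Type*) (G : Type*) [CommRing k] [Group G] :
    Representation k G (G → k) where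
  toFun s := LinearMap.funLeft k k fun x => x * s
  map_one' := by ext; simp [LinearMap.funLeft_apply]
  map_mul' s t := by ext; simp [LinearMap.funLeft_apply, mul_assoc]

/-- The action of `G` on functions by left translation. -/
def leftTranslation (k : Type*) (G : Type*) [CommRing k] [Group G] :
    Representation k G (G → k) where
  toFun s := LinearMap.funLeft k k fun x => s⁻¹ * x
  map_one' := by ext; simp [LinearMap.funLeft_apply]
  map_mul' s t := by ext; simp [LinearMap.funLeft_apply, mul_assoc]

@[simp]
theorem rightTranslation_apply {k : Type*} {G : Type*} [CommRing k] [Group G] (s : G) (f : G → k)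
    (x : G) : rightTranslation k G s f x = f (x * s) := rfl

@[simp]
theorem leftTranslation_apply {k : Type*} {G : Type*} [CommRing k] [Group G] (s : G) (f : G → k)
    (x : G) : leftTranslation k G s f x = f (s⁻¹ * x) := rfl

theorem trace_funLeft {k : Type*} [CommRing k] {ι : Type*} [Fintype ι] [DecidableEq ι]
    (σ : ι → ι) : LinearMap.trace k (ι → k) (LinearMap.funLeft k k σ) =
      Fintype.card {i // σ i = i} := by
  rw [LinearMap.trace_eq_matrix_trace k (Pi.basisFun k ι), Matrix.trace]
  simp [LinearMap.funLeft_apply, Pi.single_apply,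
    Fintype.card_subtype]

/-- Over an algebraically closed field of characteristic zero, two elements of a finite group on
which all characters agree are conjugate. -/
theorem isConj_of_trace_eq {k : Type u} [Field k] [IsAlgClosed k] [CharZero k] {G : Type}
    [Group G] [Finite G] {g h : G}
    (H : ∀ (V : Type u) [AddCommGroup V] [Module k V] [Module.Finite k V]
      (ρ : Representation k G V), LinearMap.trace k V (ρ g) = LinearMap.trace k V (ρ h)) :
    IsConj g h := by
  classical
  have := Fintype.ofFinite G
  -- Left and right translations commute, so each generalised eigenspace of right translation by `g`
  -- is a representation under left translation. The hypothesis makes the trace of `T` vanish on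
  -- each, hence `T` composed with right translation by `g` has trace zero.
  let T : Module.End k (G → k) := leftTranslation k G g - leftTranslation k G h
  have hcomm (s t : G) : Commute (rightTranslation k G t) (leftTranslation k G s) := by
    refine LinearMap.ext fun f => funext fun x => ?_
    simp [mul_assoc]
  have hT : Commute (rightTranslation k G g) T := (hcomm g g).sub_right (hcomm h g)
  have h0 : LinearMap.trace k _ (T ∘ₗ rightTranslation k G g) = 0 := by
    refine LinearMap.trace_comp_eq_zero_of_commute_of_trace_restrict_eq_zero hT
      (Module.End.iSup_maxGenEigenspace_eq_top _) fun μ => ?_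
    let W : Subrepresentation (leftTranslation k G) :=
      ⟨Module.End.maxGenEigenspace (rightTranslation k G g) μ, fun s v hv =>
        Module.End.mapsTo_maxGenEigenspace_of_comm (hcomm s g) μ hv⟩
    have h1 := H W.toSubmodule W.toRepresentation
    rw [← sub_eq_zero, ← map_sub] at h1
    exact h1
  -- This trace counts the `x` with `x * g * x⁻¹ = s`. The count is positive for `s = g`, by `x =
  -- 1`, and is the same for `s = h`; characteristic zero lets the counts be compared as natural
  -- numbers.
  have h1 (s : G) : LinearMap.trace k _ (leftTranslation k G s ∘ₗ rightTranslation k G g) =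
      Fintype.card {x // s⁻¹ * x * g = x} := trace_funLeft _
  have h2 : T ∘ₗ rightTranslation k G g = leftTranslation k G g ∘ₗ rightTranslation k G g -
      leftTranslation k G h ∘ₗ rightTranslation k G g := LinearMap.sub_comp _ _ _
  rw [h2, map_sub, h1, h1, sub_eq_zero, Nat.cast_inj] at h0
  have h3 : 0 < Fintype.card {x // g⁻¹ * x * g = x} := Fintype.card_pos_iff.2 ⟨⟨1, by simp⟩⟩
  rw [h0, Fintype.card_pos_iff] at h3
  obtain ⟨x, hx⟩ := h3
  refine isConj_iff.2 ⟨x, ?_⟩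
  rw [mul_inv_eq_iff_eq_mul]
  nth_rw 2 [← hx]
  group

/-- The trace of the inverse of a complex operator of finite order is the complex conjugate of its
trace. -/
theorem trace_eq_conj_of_pow_eq_one {V : Type*} [AddCommGroup V] [Module ℂ V] [Module.Finite ℂ V]
    {f f' : Module.End ℂ V} {n : ℕ} (hn : n ≠ 0) (hf : f ^ n = 1) (hf' : f' * f = 1) :
    LinearMap.trace ℂ V f' = starRingEnd ℂ (LinearMap.trace ℂ V f) := by
  classical
  have hss : f.IsSemisimple := by
    refine Module.End.isSemisimple_of_squarefree_aeval_eq_zero (p := Polynomial.X ^ n - 1)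
      (Polynomial.separable_X_pow_sub_C (1 : ℂ) (by exact_mod_cast hn) one_ne_zero).squarefree ?_
    simp [hf]
  have hint : DirectSum.IsInternal f.eigenspace :=
    DirectSum.isInternal_submodule_of_iSupIndep_of_iSup_eq_top f.eigenspaces_iSupIndep (by
      simpa only [hss.isFinitelySemisimple.maxGenEigenspace_eq_eigenspace] using
        f.iSup_maxGenEigenspace_eq_top)
  have hfin : {μ | f.eigenspace μ ≠ ⊥}.Finite :=
    WellFoundedGT.finite_ne_bot_of_iSupIndep f.eigenspaces_iSupIndep
  have hinv {μ : ℂ} {v : V} (hv : v ∈ f.eigenspace μ) : μ • f' v = v := by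
    rw [← map_smul, ← Module.End.mem_eigenspace_iff.1 hv, ← Module.End.mul_apply, hf',
      Module.End.one_apply]
  have hpow {μ : ℂ} {v : V} (hv : v ∈ f.eigenspace μ) (hv0 : v ≠ 0) : μ ^ n = 1 := by
    have h1 : ∀ m : ℕ, (f ^ m) v = μ ^ m • v := by
      intro m
      induction m with
      | zero => simp
      | succ m ih =>
        rw [pow_succ', Module.End.mul_apply, ih, map_smul, Module.End.mem_eigenspace_iff.1 hv,
          smul_smul, ← pow_succ]
    have h2 := h1 n
    rw [hf, Module.End.one_apply] at h2
    exact (smul_left_injective ℂ hv0 (by simpa using h2)).symm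
  -- Eigenvalues are roots of unity, so inverting them is complex conjugation.
  have hconj {μ : ℂ} {v : V} (hv : v ∈ f.eigenspace μ) : f' v = starRingEnd ℂ μ • v := by
    by_cases hv0 : v = 0
    · simp [hv0]
    have h1 : ‖μ‖ = 1 := Complex.norm_eq_one_of_pow_eq_one (hpow hv hv0) hn
    nth_rw 2 [← hinv hv]
    rw [smul_smul, ← Complex.normSq_eq_conj_mul_self, Complex.normSq_eq_norm_sq, h1]
    simp
  have hm (μ : ℂ) : Set.MapsTo f (f.eigenspace μ) (f.eigenspace μ) := fun v hv => by
    rw [SetLike.mem_coe] at hv ⊢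
    rw [Module.End.mem_eigenspace_iff.1 hv]
    exact Submodule.smul_mem _ _ hv
  have hm' (μ : ℂ) : Set.MapsTo f' (f.eigenspace μ) (f.eigenspace μ) := fun v hv => by
    rw [SetLike.mem_coe] at hv ⊢
    rw [hconj hv]
    exact Submodule.smul_mem _ _ hv
  rw [LinearMap.trace_eq_sum_trace_restrict' hint hfin hm,
    LinearMap.trace_eq_sum_trace_restrict' hint hfin hm', map_sum]
  refine Finset.sum_congr rfl fun μ _ => ?_
  have h1 : f.restrict (hm μ) = μ • LinearMap.id :=
    LinearMap.ext fun v => Subtype.ext (Module.End.mem_eigenspace_iff.1 v.2)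
  have h2 : f'.restrict (hm' μ) = starRingEnd ℂ μ • LinearMap.id :=
    LinearMap.ext fun v => Subtype.ext (hconj v.2)
  rw [h1, h2]
  simp

theorem trace_inv_eq_conj {G : Type*} [Group G] [Finite G] {V : Type*} [AddCommGroup V]
    [Module ℂ V] [Module.Finite ℂ V] (ρ : Representation ℂ G V) (g : G) :
    LinearMap.trace ℂ V (ρ g⁻¹) = starRingEnd ℂ (LinearMap.trace ℂ V (ρ g)) :=
  trace_eq_conj_of_pow_eq_one (orderOf_pos g).ne' (by rw [← map_pow, pow_orderOf_eq_one, map_one])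
    (by rw [← map_mul, inv_mul_cancel, map_one])

theorem simple_of_isIrreducible {G : Type} [Group G] [Finite G] {V : Type} [AddCommGroup V]
    [Module ℂ V] [Module.Finite ℂ V] (ρ : Representation ℂ G V) [IsIrreducible ρ] :
    Simple (FDRep.of ρ) := by
  have := Fintype.ofFinite G
  have hG : (Nat.card G : ℂ) ≠ 0 := by exact_mod_cast Nat.card_pos.ne'
  have := invertibleOfNonzero hG
  rw [FDRep.simple_iff_char_is_norm_one]
  have h := char_orthonormal ρ ρ
  rw [if_pos ⟨Equiv.refl ρ⟩, inv_mul_eq_one₀ hG] at h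
  exact h.symm

/-- If some complex representation of a finite group has a character with a non-real value at `g`,
then so does some irreducible representation. -/
theorem exists_simple_of_im_ne_zero {G : Type} [Group G] [Finite G] (g : G) {V : Type}
    [AddCommGroup V] [Module ℂ V] [Module.Finite ℂ V] (ρ : Representation ℂ G V)
    (h : (LinearMap.trace ℂ V (ρ g)).im ≠ 0) :
    ∃ W : FDRep ℂ G, Simple W ∧ (W.character g).im ≠ 0 := by
  induction hn : Module.finrank ℂ V using Nat.strong_induction_on generalizing V with
  | _ n ih =>
  by_cases hρ : IsIrreducible ρ
  · exact ⟨FDRep.of ρ, simple_of_isIrreducible ρ, h⟩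
  have : NeZero (Nat.card G : ℂ) := ⟨by exact_mod_cast Nat.card_pos.ne'⟩
  have hV : Nontrivial V := by
    by_contra hV
    rw [not_nontrivial_iff_subsingleton] at hV
    rw [Subsingleton.elim (ρ g) 0] at h
    simp at h
  have : Nontrivial (Subrepresentation ρ) := by
    refine ⟨⊥, ⊤, fun h => ?_⟩
    have h1 : (⊥ : Submodule ℂ V) = ⊤ := congr(Subrepresentation.toSubmodule $h)
    exact bot_ne_top h1
  obtain ⟨W, hW0, hW1⟩ : ∃ W : Subrepresentation ρ, W ≠ ⊥ ∧ W ≠ ⊤ := by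
    by_contra! hW
    exact hρ ⟨fun W => or_iff_not_imp_left.2 (hW W)⟩
  -- By Maschke's theorem the trace is a sum over two smaller representations, one of which must
  -- keep a nonzero imaginary part.
  obtain ⟨W', hWW'⟩ := exists_isCompl W
  have hc : IsCompl W.toSubmodule W'.toSubmodule :=
    ⟨disjoint_iff.2 congr(Subrepresentation.toSubmodule $(hWW'.inf_eq_bot)),
      codisjoint_iff.2 congr(Subrepresentation.toSubmodule $(hWW'.sup_eq_top))⟩
  have hlt : ∀ U : Subrepresentation ρ, U ≠ ⊤ → Module.finrank ℂ U.toSubmodule < n := by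
    intro U hU
    rw [← hn]
    refine Submodule.finrank_lt fun h => hU (Subrepresentation.toSubmodule_injective h)
  have hW1' : W' ≠ ⊤ := by
    rintro rfl
    exact hW0 (by simpa using hWW'.inf_eq_bot)
  have htr : LinearMap.trace ℂ V (ρ g) = LinearMap.trace ℂ W.toSubmodule (W.toRepresentation g) +
      LinearMap.trace ℂ W'.toSubmodule (W'.toRepresentation g) := by
    rw [← LinearMap.trace_prodMap', ← LinearMap.trace_conj' _ (Submodule.prodEquivOfIsCompl _ _ hc)]
    congr 1
    refine LinearMap.ext fun v => ?_
    obtain ⟨⟨w, w'⟩, rfl⟩ := (Submodule.prodEquivOfIsCompl _ _ hc).surjective v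
    rw [LinearEquiv.conj_apply_apply, LinearEquiv.symm_apply_apply]
    exact map_add (ρ g) (w : V) (w' : V)
  by_cases h1 : (LinearMap.trace ℂ W.toSubmodule (W.toRepresentation g)).im = 0
  · refine ih _ (hlt W' hW1') W'.toRepresentation ?_ rfl
    rw [htr, Complex.add_im, h1, zero_add] at h
    exact h
  · exact ih _ (hlt W hW1) W.toRepresentation h1 rfl

/-- If `g` is not conjugate to its inverse, then some irreducible complex character is not real
at `g`. -/
theorem exists_simple_of_not_isConj_inv {G : Type} [Group G] [Finite G] {g : G}
    (hg : ¬ IsConj g g⁻¹) : ∃ W : FDRep ℂ G, Simple W ∧ (W.character g).im ≠ 0 := by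
  by_contra! h
  refine hg (isConj_of_trace_eq (k := ℂ) fun V _ _ _ ρ => ?_)
  by_contra h1
  rw [trace_inv_eq_conj, eq_comm, Complex.conj_eq_iff_im] at h1
  obtain ⟨W, hW, h2⟩ := exists_simple_of_im_ne_zero g ρ h1
  exact h2 (h W hW)

end Representation

/-! ### Objects concentrated in degree one and the algebra of functions -/

namespace DrinfeldCentre

noncomputable section

open TensorProduct

variable {k : Type u} [Field k]

open scoped MonObj

/-! ### Representations as objects in degree one. -/

section Concentrated

variable {G : Type v} [Group G]

theorem eq_zero_of_mem_grading {V : DrinfeldCentre k G} (hV : V.grading 1 = ⊤) {g : G} (hg : g ≠ 1)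
    {v : V} (hv : v ∈ V.grading g) : v = 0 := by
  have h := (Submodule.disjoint_def.1 (V.indep g)) v hv
  refine h (Submodule.mem_iSup_of_mem 1 (Submodule.mem_iSup_of_mem hg.symm ?_))
  rw [hV]
  trivial

/-- An equivariant map between objects concentrated in degree `1`. -/
@[simps]
def homMk {V W : DrinfeldCentre k G} (hV : V.grading 1 = ⊤) (hW : W.grading 1 = ⊤) (φ : V →ₗ[k] W)
    (h : ∀ g v, φ (V.ρ g v) = W.ρ g (φ v)) : V ⟶ W where
  hom := φ
  map_mem g v hv := by
    by_cases hg : g = 1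
    · rw [hg, hW]
      trivial
    · rw [eq_zero_of_mem_grading hV hg hv, map_zero]
      exact zero_mem _
  map_ρ := h

theorem grading_one_of_iso {V W : DrinfeldCentre k G} (e : V ≅ W) (hV : V.grading 1 = ⊤) :
    W.grading 1 = ⊤ := by
  refine eq_top_iff.2 fun w _ => ?_
  have h : e.hom.hom (e.inv.hom w) = w := LinearMap.congr_fun congr(($(e.inv_hom_id)).hom) w
  rw [← h]
  exact e.hom.map_mem 1 _ (by rw [hV]; trivial)

theorem grading_one_dual [Finite G] {V : DrinfeldCentre k G} (hV : V.grading 1 = ⊤) :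
    (dual V).grading 1 = ⊤ := by
  refine eq_top_iff.2 fun l _ h hh v hv => ?_
  rw [eq_zero_of_mem_grading hV (by simpa using hh) hv, map_zero]

/-- The grading concentrated in degree `1`. -/
def gradingOne (M : Type*) [AddCommGroup M] [Module k M] (g : G) : Submodule k M where
  carrier := {m | g ≠ 1 → m = 0}
  add_mem' ha hb hg := by rw [ha hg, hb hg, add_zero]
  zero_mem' _ := rfl
  smul_mem' c x hx hg := by rw [hx hg, smul_zero]

theorem gradingOne_one (M : Type*) [AddCommGroup M] [Module k M] :
    gradingOne (k := k) M (1 : G) = ⊤ := eq_top_iff.2 fun _ _ h => absurd rfl h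

/-- A representation, as an object concentrated in degree `1`. -/
abbrev ofRep {V : Type u} [AddCommGroup V] [Module k V] [Module.Finite k V]
    (ρ : Representation k G V) : DrinfeldCentre k G where
  carrier := V
  ρ := ρ
  grading := gradingOne V
  indep := by
    classical
    refine iSupIndep_of_proj (fun g => if g = 1 then LinearMap.id else 0) ?_ ?_
    · intro g m hm
      by_cases hg : g = 1
      · simp [hg]
      · simp [hg, hm hg]
    · intro g h hne m hm
      by_cases hg : g = 1
      · simp [hg, hm (hg ▸ hne)]
      · simp [hg]
  iSup_eq_top := eq_top_iff.2 ((gradingOne_one V).symm.le.trans (le_iSup (gradingOne V) (1 : G)))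
  compatible := by
    refine compatible_of_le ρ fun f g m hm h => ?_
    rw [hm fun hg => h (by simp [hg]), map_zero]

theorem ofRep_grading_one {V : Type u} [AddCommGroup V] [Module k V] [Module.Finite k V]
    (ρ : Representation k G V) : (ofRep ρ).grading 1 = ⊤ := gradingOne_one V

theorem unit_grading_one : (unit k G).grading 1 = ⊤ := unitGrading_one

theorem tensorObj_grading_one {V W : DrinfeldCentre k G} (hV : V.grading 1 = ⊤)
    (hW : W.grading 1 = ⊤) : (tensorObj V W).grading 1 = ⊤ := by
  refine eq_top_iff.2 fun x _ => ?_
  induction x using TensorProduct.induction_on with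
  | zero => exact zero_mem _
  | add x y hx hy => exact add_mem (hx trivial) (hy trivial)
  | tmul v w =>
    have h := tmul_mem (V := V) (W := W) (a := 1) (b := 1) (v := v) (w := w) (by rw [hV]; trivial)
      (by rw [hW]; trivial)
    rwa [mul_one] at h

/-- The braiding of an object concentrated in degree `1` with itself is the flip. -/
theorem braiding_hom_tmul {V W : DrinfeldCentre k G} (hV : V.grading 1 = ⊤) (v : V) (w : W) :
    (β_ V W).hom.hom (v ⊗ₜ[k] w) = w ⊗ₜ v := by
  change braidMap V W (v ⊗ₜ w) = _
  rw [braidMap_tmul V W (a := 1) (by rw [hV]; trivial)]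
  simp

section MonHom

variable {B C : DrinfeldCentre k G} [MonObj B] [MonObj C]

theorem monHom_one (f : B ⟶ C) [IsMonHom f] : f.hom ((η[B]).hom (1 : k)) = (η[C]).hom (1 : k) :=
  LinearMap.congr_fun congr(($(IsMonHom.one_hom f)).hom) (1 : k)

theorem monHom_mul (f : B ⟶ C) [IsMonHom f] (x y : B) :
    f.hom ((μ[B]).hom (x ⊗ₜ[k] y)) = (μ[C]).hom (f.hom x ⊗ₜ[k] f.hom y) :=
  LinearMap.congr_fun congr(($(IsMonHom.mul_hom f)).hom) (x ⊗ₜ[k] y)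

theorem isMonHom_of_apply (f : B ⟶ C) (h1 : f.hom ((η[B]).hom (1 : k)) = (η[C]).hom (1 : k))
    (hm : ∀ x y : B, f.hom ((μ[B]).hom (x ⊗ₜ[k] y)) = (μ[C]).hom (f.hom x ⊗ₜ[k] f.hom y)) :
    IsMonHom f where
  one_hom := hom_ext (LinearMap.ext_ring h1)
  mul_hom := hom_ext (TensorProduct.ext' hm)

end MonHom

/-! #### Characters of commutative algebras -/

section Algebra

variable (B : DrinfeldCentre k G) [MonObj B]

/-- The multiplication of an algebra in `Z(G)`. -/
def algMul (x y : B) : B := (μ[B]).hom (x ⊗ₜ[k] y)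

/-- The unit of an algebra in `Z(G)`. -/
def algOne : B := (η[B]).hom (1 : k)

theorem algMul_ρ (g : G) (x y : B) : algMul B (B.ρ g x) (B.ρ g y) = B.ρ g (algMul B x y) :=
  (μ[B]).map_ρ g (x ⊗ₜ[k] y)

theorem algOne_ρ (g : G) : B.ρ g (algOne B) = algOne B := ((η[B]).map_ρ g (1 : k)).symm

theorem one_algMul (x : B) : algMul B (algOne B) x = x := by
  have h := LinearMap.congr_fun congr(($(MonObj.one_mul B)).hom) ((1 : k) ⊗ₜ[k] x)
  exact h.trans (one_smul k x)

theorem algMul_one (x : B) : algMul B x (algOne B) = x := by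
  have h := LinearMap.congr_fun congr(($(MonObj.mul_one B)).hom) (x ⊗ₜ[k] (1 : k))
  exact h.trans (one_smul k x)

theorem algMul_assoc (x y z : B) : algMul B (algMul B x y) z = algMul B x (algMul B y z) :=
  LinearMap.congr_fun congr(($(MonObj.mul_assoc B)).hom) ((x ⊗ₜ[k] y) ⊗ₜ[k] z)

theorem algMul_comm [IsCommMonObj B] (hB : B.grading 1 = ⊤) (x y : B) :
    algMul B x y = algMul B y x := by
  have h := LinearMap.congr_fun congr(($(IsCommMonObj.mul_comm B)).hom) (x ⊗ₜ[k] y)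
  rw [comp_hom, LinearMap.comp_apply] at h
  erw [braiding_hom_tmul hB] at h
  exact h.symm

/-- The commutative ring underlying a commutative algebra concentrated in degree `1`. -/
abbrev commRing [IsCommMonObj B] (hB : B.grading 1 = ⊤) : CommRing B where
  __ := (inferInstance : AddCommGroup B)
  mul := algMul B
  one := algOne B
  left_distrib x y z := by
    change (μ[B]).hom (x ⊗ₜ[k] (y + z)) = _
    rw [TensorProduct.tmul_add, map_add]
    rfl
  right_distrib x y z := by
    change (μ[B]).hom ((x + y) ⊗ₜ[k] z) = _
    rw [TensorProduct.add_tmul, map_add]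
    rfl
  zero_mul x := by
    change (μ[B]).hom (0 ⊗ₜ[k] x) = _
    rw [TensorProduct.zero_tmul, map_zero]
  mul_zero x := by
    change (μ[B]).hom (x ⊗ₜ[k] 0) = _
    rw [TensorProduct.tmul_zero, map_zero]
  mul_assoc := algMul_assoc B
  one_mul := one_algMul B
  mul_one := algMul_one B
  mul_comm := algMul_comm B hB

/-- The quotient by a maximal ideal is a finite extension of `k`, hence embeds into `k` since `k` is
algebraically closed. -/
theorem exists_character [IsAlgClosed k] [IsCommMonObj B] (hB : B.grading 1 = ⊤)
    [Nontrivial B] : ∃ e : B →ₗ[k] k, e (algOne B) = 1 ∧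
      ∀ x y, e (algMul B x y) = e x * e y := by
  let : CommRing B := commRing B hB
  let : Algebra k B := Algebra.ofModule
    (fun c x y => by
      change (μ[B]).hom ((c • x) ⊗ₜ[k] y) = c • (μ[B]).hom (x ⊗ₜ[k] y)
      rw [← map_smul, TensorProduct.smul_tmul'])
    (fun c x y => by
      change (μ[B]).hom (x ⊗ₜ[k] (c • y)) = c • (μ[B]).hom (x ⊗ₜ[k] y)
      rw [← map_smul, TensorProduct.tmul_smul])
  obtain ⟨M, hM⟩ := Ideal.exists_maximal B
  let : Field (B ⧸ M) := Ideal.Quotient.field M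
  have : Module.Finite k (B ⧸ M) := Module.Finite.of_surjective
    (Ideal.Quotient.mkₐ k M).toLinearMap (Ideal.Quotient.mkₐ_surjective k M)
  let e : (B ⧸ M) →ₐ[k] k := IsAlgClosed.lift
  let e' : B →ₐ[k] k := e.comp (Ideal.Quotient.mkₐ k M)
  exact ⟨e'.toLinearMap, map_one e', map_mul e'⟩

end Algebra

end Concentrated

/-! ### The algebra of functions and its endomorphisms. -/

variable {G : Type} [Group G] [Finite G]

variable (k G) in
/-- The algebra of functions on `G`, with the action by right translation. -/
abbrev functions : DrinfeldCentre k G := ofRep (Representation.rightTranslation k G)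

theorem functions_grading_one : (functions k G).grading 1 = ⊤ := ofRep_grading_one _

variable (k G) in
/-- The multiplication of functions. -/
def functionsMul : tensorObj (functions k G) (functions k G) ⟶ functions k G :=
  homMk (tensorObj_grading_one functions_grading_one functions_grading_one) functions_grading_one
    (LinearMap.mul' k (G → k)) fun g x => by
      have h : LinearMap.mul' k (G → k) ∘ₗ ((Representation.rightTranslation k G).tprod
          (Representation.rightTranslation k G)) g =
          Representation.rightTranslation k G g ∘ₗ LinearMap.mul' k (G → k) :=
        TensorProduct.ext' fun a b => by ext; simp
      exact LinearMap.congr_fun h x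

variable (k G) in
/-- The constant functions. -/
def functionsOne : unit k G ⟶ functions k G :=
  homMk unit_grading_one functions_grading_one (Algebra.linearMap k (G → k)) fun g c => by
    ext; simp

instance : MonObj (functions k G) where
  one := functionsOne k G
  mul := functionsMul k G
  one_mul := hom_ext (TensorProduct.ext' fun c f => by
    exact (Algebra.smul_def (c : k) (f : G → k)).symm)
  mul_one := hom_ext (TensorProduct.ext' fun f c => by
    exact (mul_comm _ _).trans (Algebra.smul_def (c : k) (f : G → k)).symm)
  mul_assoc := hom_ext (TensorProduct.ext_threefold fun f₁ f₂ f₃ => by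
    change f₁ * f₂ * f₃ = f₁ * (f₂ * f₃)
    rw [mul_assoc])

theorem mul_hom_tmul (f₁ f₂ : G → k) : (μ[functions k G]).hom (f₁ ⊗ₜ f₂) = f₁ * f₂ := rfl

instance : IsCommMonObj (functions k G) where
  mul_comm := hom_ext (TensorProduct.ext' fun f₁ f₂ => by
    rw [comp_hom, LinearMap.comp_apply]
    erw [braiding_hom_tmul functions_grading_one, mul_hom_tmul, mul_hom_tmul, mul_comm])

variable (k) in
/-- The left translation `f ↦ f (h * ·)` of functions. -/
def translate (h : G) : functions k G ⟶ functions k G :=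
  homMk functions_grading_one functions_grading_one (LinearMap.funLeft k k fun x => h * x)
    fun g f => by
      ext
      simp [LinearMap.funLeft_apply, mul_assoc]

theorem translate_hom_apply (h : G) (f : G → k) (x : G) :
    (translate k h).hom f x = f (h * x) := rfl

instance (h : G) : IsMonHom (translate k h) := isMonHom_of_apply _ rfl fun _ _ => rfl

theorem translate_comp (h h' : G) : translate k h ≫ translate k h' = translate k (h * h') := by
  refine hom_ext (LinearMap.ext fun f => funext fun x => ?_)
  rw [comp_hom, LinearMap.comp_apply, translate_hom_apply, translate_hom_apply,
    translate_hom_apply, mul_assoc]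

theorem translate_injective : Function.Injective (translate k : G → _) := by
  classical
  intro h h' e
  have h1 : (translate k h).hom (Pi.single h (1 : k)) 1 =
      (translate k h').hom (Pi.single h (1 : k)) 1 := by rw [e]
  rw [translate_hom_apply, translate_hom_apply, mul_one, mul_one, Pi.single_eq_same] at h1
  by_contra hne
  rw [Pi.single_eq_of_ne (Ne.symm hne)] at h1
  exact one_ne_zero h1

/-- An algebra endomorphism of the algebra of functions in `Z(G)` is a left translation. -/
theorem exists_eq_translate (f : functions k G ⟶ functions k G) [IsMonHom f] :
    ∃ h, f = translate k h := by
  -- Composing with evaluation at `1` gives a character of `G → k`, which is evaluation at a point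
  -- `h`; equivariance then determines `f` everywhere.
  let φ : (G → k) →ₐ[k] k := AlgHom.ofLinearMap (LinearMap.proj 1 ∘ₗ f.hom)
    (congr_fun (monHom_one f) 1) (fun x y => congr_fun (monHom_mul f x y) 1)
  obtain ⟨h, hh⟩ := φ.eq_piEvalAlgHom
  refine ⟨h, hom_ext (LinearMap.ext fun a => funext fun x => ?_)⟩
  have h1 := congr_fun (f.map_ρ x a) 1
  have h2 : f.hom ((functions k G).ρ x a) 1 = a (h * x) :=
    AlgHom.congr_fun hh ((functions k G).ρ x a)
  rw [h2] at h1
  rw [translate_hom_apply, h1]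
  change _ = f.hom a (1 * x)
  rw [one_mul]

section Character

variable (B : DrinfeldCentre k G) [MonObj B]

/-- The map to the algebra of functions given by a character of an algebra. -/
def toFunctions (hB : B.grading 1 = ⊤) (e : B →ₗ[k] k) : B ⟶ functions k G :=
  homMk hB functions_grading_one (LinearMap.pi fun x => e ∘ₗ B.ρ x) fun g v => by
    ext x
    simp

/-- Since the group acts by algebra automorphisms, `b ↦ (x ↦ e (x b))` is multiplicative as soon as
`e` is. -/
theorem isMonHom_toFunctions (hB : B.grading 1 = ⊤) {e : B →ₗ[k] k} (h1 : e (algOne B) = 1)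
    (hm : ∀ x y, e (algMul B x y) = e x * e y) : IsMonHom (toFunctions B hB e) := by
  refine isMonHom_of_apply _ (funext fun g => ?_) fun x y => funext fun g => ?_
  · change e (B.ρ g (algOne B)) = algebraMap k (G → k) 1 g
    rw [algOne_ρ, h1, map_one, Pi.one_apply]
  · change e (B.ρ g (algMul B x y)) = e (B.ρ g x) * e (B.ρ g y)
    rw [← algMul_ρ, hm]

end Character

end

end DrinfeldCentre

/-! ### Dualising braided autoequivalences and class-inverting automorphisms -/

namespace DrinfeldCentre

noncomputable section

open TensorProduct

open scoped MonObj Obj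

variable {k : Type u} [Field k] {G : Type} [Group G]

theorem isIso_of_ker_eq_bot {V : DrinfeldCentre k G} (t : V ⟶ V) (ht : LinearMap.ker t.hom = ⊥) :
    IsIso t := by
  let e := isoMk (LinearEquiv.ofInjectiveEndo t.hom (LinearMap.ker_eq_bot.1 ht))
    (fun g v hv => t.map_mem g v hv) (fun g v => t.map_ρ g v)
  have h : e.hom = t := hom_ext rfl
  rw [← h]
  infer_instance

theorem rightTranslation_single [DecidableEq G] (g x : G) (c : k) :
    Representation.rightTranslation k G g (Pi.single x c) = Pi.single (x * g⁻¹) c := by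
  ext y
  simp [Pi.single_apply, eq_mul_inv_iff_mul_eq]

variable [Finite G]

/-- The algebra of functions is self-dual. -/
def functionsIsoDual : dual (functions k G) ≅ functions k G := by
  classical
  have := Fintype.ofFinite G
  exact isoMk (LinearEquiv.piRing k k G k)
    (fun g l hl hg => by
      rw [eq_zero_of_mem_grading (grading_one_dual functions_grading_one) hg hl, map_zero])
    (fun g l => by
      ext x
      change l (Representation.rightTranslation k G g⁻¹ (Pi.single x (1 : k))) =
        l (Pi.single (x * g) (1 : k))
      rw [rightTranslation_single, inv_inv])

/-- The kernel of an endomorphism of the algebra of functions. -/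
abbrev kernel (t : functions k G ⟶ functions k G) : DrinfeldCentre k G :=
  ofRep (Subrepresentation.toRepresentation (ρ := Representation.rightTranslation k G)
    ⟨LinearMap.ker t.hom, fun g v hv => by
      rw [LinearMap.mem_ker] at hv ⊢
      have h := t.map_ρ g v
      rw [hv, map_zero] at h
      exact h⟩)

/-- The inclusion of the kernel. -/
def kernelι (t : functions k G ⟶ functions k G) : kernel t ⟶ functions k G :=
  homMk (ofRep_grading_one _) functions_grading_one (LinearMap.ker t.hom).subtype fun _ _ => rfl

theorem kernelι_comp (t : functions k G ⟶ functions k G) : kernelι t ≫ t = 0 :=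
  hom_ext (LinearMap.ext fun x => x.2)

/-- If the kernel is an ideal containing a function nonzero at `p`, it contains the delta function
at `p`. Right translations are transitive on delta functions, so it contains them all and `t = 0`.
-/
theorem eq_zero_of_ideal {t : functions k G ⟶ functions k G}
    (h : functions k G ◁ kernelι t ≫ μ[functions k G] ≫ t = 0) (ht : t ≠ 0) :
    LinearMap.ker t.hom = ⊥ := by
  classical
  have := Fintype.ofFinite G
  have hideal (a x : G → k) (hx : t.hom x = 0) : t.hom (a * x) = 0 :=
    LinearMap.congr_fun congr(($h).hom) (a ⊗ₜ[k] (⟨x, hx⟩ : LinearMap.ker t.hom))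
  rw [LinearMap.ker_eq_bot']
  intro x hx
  by_contra hx0
  obtain ⟨p, hp⟩ := Function.ne_iff.1 hx0
  have h1 : t.hom (Pi.single p (1 : k)) = 0 := by
    rw [← hideal (Pi.single p (x p)⁻¹) x hx]
    congr 1
    ext y
    by_cases hy : y = p
    · subst hy
      simp [inv_mul_cancel₀ hp]
    · simp [Pi.single_eq_of_ne hy]
  have h2 (y : G) : t.hom (Pi.single y (1 : k)) = 0 := by
    have h3 := t.map_ρ (y⁻¹ * p) (Pi.single p (1 : k))
    rw [h1, map_zero] at h3
    rw [← h3]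
    change _ = t.hom (Representation.rightTranslation k G (y⁻¹ * p) (Pi.single p (1 : k)))
    rw [rightTranslation_single, mul_inv_rev, inv_inv, mul_inv_cancel_left]
  refine ht (hom_ext (LinearMap.pi_ext' fun y => LinearMap.ext_ring ?_))
  exact h2 y

/-! ### The automorphism induced by a braided autoequivalence. -/

section Functor

variable (F : DrinfeldCentre k G ⥤ DrinfeldCentre k G) [F.Braided] [F.IsEquivalence]

/-- A morphism of algebras from the image of the algebra of functions to the algebra of functions
is an isomorphism. -/
theorem isIso_of_isMonHom [F.Additive] (j : functions k G ≅ F.obj (functions k G))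
    (θ : F.obj (functions k G) ⟶ functions k G) [IsMonHom θ] : IsIso θ := by
  -- Fullness turns `θ`, followed by the plain isomorphism `j`, into an endomorphism of the algebra
  -- of functions itself, where the kernel can be analysed.
  let t : functions k G ⟶ functions k G := F.preimage (θ ≫ j.hom)
  have ht : F.map t = θ ≫ j.hom := F.map_preimage _
  have hθ : θ = F.map t ≫ j.inv := by rw [ht, Category.assoc, j.hom_inv_id, Category.comp_id]
  have h1 : F.map (kernelι t) ≫ θ = 0 := by
    rw [hθ, ← Category.assoc, ← F.map_comp, kernelι_comp, F.map_zero, Limits.zero_comp]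
  -- The kernel of `t` is an ideal: after applying the faithful functor `F` and cancelling its
  -- tensor constraint, this follows from multiplicativity of `θ`, which kills the image of the
  -- kernel.
  have h2 : functions k G ◁ kernelι t ≫ μ[functions k G] ≫ t = 0 := by
    apply F.map_injective
    rw [F.map_zero, F.map_comp, F.map_comp,
      ← cancel_epi (Functor.LaxMonoidal.μ F (functions k G) (kernel t)),
      ← Functor.LaxMonoidal.μ_natural_right_assoc, ht, Limits.comp_zero]
    have h3 : Functor.LaxMonoidal.μ F (functions k G) (functions k G) ≫ F.map μ[functions k G] ≫
        θ = (θ ⊗ₘ θ) ≫ μ[functions k G] := by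
      rw [← IsMonHom.mul_hom θ, Functor.obj.μ_def, Category.assoc]
    have h4 : F.obj (functions k G) ◁ F.map (kernelι t) ≫ (θ ⊗ₘ θ) = 0 := by
      rw [whiskerLeft_comp_tensorHom, h1]
      exact hom_ext (TensorProduct.map_zero_right _)
    rw [reassoc_of% h3, reassoc_of% h4, Limits.zero_comp]
  -- Otherwise `θ` would be zero, yet it preserves units and `1 ≠ 0` in the algebra of functions.
  have h3 : t ≠ 0 := by
    intro h
    have h4 := monHom_one θ
    rw [hθ, h, F.map_zero, Limits.zero_comp] at h4
    exact zero_ne_one (congr_fun h4 1)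
  have := isIso_of_ker_eq_bot t (eq_zero_of_ideal h2 h3)
  rw [hθ]
  infer_instance

theorem exists_iso [IsAlgClosed k] [F.Additive] (j : functions k G ≅ F.obj (functions k G)) :
    ∃ θ : F.obj (functions k G) ≅ functions k G, IsMonHom θ.hom := by
  have hB := grading_one_of_iso j functions_grading_one
  have : Nontrivial (F.obj (functions k G)) := by
    refine ⟨j.hom.hom (1 : G → k), 0, fun h => ?_⟩
    have h1 : j.inv.hom (j.hom.hom (1 : G → k)) = (1 : G → k) :=
      LinearMap.congr_fun congr(($(j.hom_inv_id)).hom) _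
    rw [h, map_zero] at h1
    exact zero_ne_one (congr_fun h1 1)
  obtain ⟨e, he1, hem⟩ := exists_character (F.obj (functions k G)) hB
  have := isMonHom_toFunctions _ hB he1 hem
  have := isIso_of_isMonHom F j (toFunctions _ hB e)
  exact ⟨asIso (toFunctions _ hB e), ‹_›⟩

/-- The automorphism of `G` induced by a braided autoequivalence of `Z(G)` that preserves the
algebra of functions. -/
theorem exists_mulAut (θ : F.obj (functions k G) ≅ functions k G) [IsMonHom θ.hom] :
    ∃ φ : MulAut G, ∀ h, F.map (translate k h) ≫ θ.hom = θ.hom ≫ translate k (φ h) := by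
  have H (h : G) : ∃ h', θ.inv ≫ F.map (translate k h) ≫ θ.hom = translate k h' :=
    exists_eq_translate _
  choose φ hφ using H
  let f : G →* G := MonoidHom.mk' φ fun h h' => by
    apply translate_injective (k := k)
    rw [← translate_comp, ← hφ, ← hφ, ← hφ, ← translate_comp, F.map_comp]
    simp
  have hf : Function.Injective f := by
    intro h h' e
    have h1 : translate k (φ h) = translate k (φ h') := congrArg _ e
    rw [← hφ, ← hφ, cancel_epi, cancel_mono] at h1
    exact translate_injective (F.map_injective h1)
  refine ⟨MulEquiv.ofBijective f (Finite.injective_iff_bijective.1 hf), fun h => ?_⟩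
  change _ = θ.hom ≫ translate k (φ h)
  rw [← hφ, Iso.hom_inv_id_assoc]

end Functor

/-! ### The algebra of functions represents the underlying vector space. -/

section Yoneda

variable [Fintype G] {V : DrinfeldCentre k G} (hV : V.grading 1 = ⊤)

/-- The morphism from the algebra of functions sending the delta function at `1` to `v`. -/
def ofVector (v : V) : functions k G ⟶ V :=
  homMk functions_grading_one hV
    (∑ x : G, (LinearMap.proj x : (G → k) →ₗ[k] k).smulRight (V.ρ x⁻¹ v)) fun g f => by
      simp only [LinearMap.sum_apply, LinearMap.smulRight_apply, LinearMap.proj_apply, map_sum,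
        map_smul]
      refine Fintype.sum_equiv (Equiv.mulRight g) _ _ fun x => ?_
      rw [Equiv.coe_mulRight, ← Module.End.mul_apply, ← map_mul, mul_inv_rev, mul_inv_cancel_left]
      rfl

theorem ofVector_hom_apply (v : V) (f : G → k) :
    (ofVector hV v).hom f = ∑ x : G, f x • V.ρ x⁻¹ v := by
  simp [ofVector]

/-- Precomposition with translations recovers the group action on `V` in purely categorical terms,
which a functor can transport. -/
theorem translate_comp_ofVector (h : G) (v : V) :
    translate k h ≫ ofVector hV v = ofVector hV (V.ρ h v) := by
  refine hom_ext (LinearMap.ext fun f => ?_)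
  rw [comp_hom, LinearMap.comp_apply, ofVector_hom_apply, ofVector_hom_apply]
  refine Fintype.sum_equiv (Equiv.mulLeft h) _ _ fun x => ?_
  rw [Equiv.coe_mulLeft, ← Module.End.mul_apply, ← map_mul, mul_inv_rev, inv_mul_cancel_right]
  rfl

/-- Morphisms from the algebra of functions to `V` correspond to vectors of `V`. -/
def homFunctionsEquiv : V ≃ₗ[k] (functions k G ⟶ V) where
  toFun := ofVector hV
  map_add' v w := hom_ext (LinearMap.ext fun f => by
    rw [add_hom, LinearMap.add_apply, ofVector_hom_apply, ofVector_hom_apply, ofVector_hom_apply,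
      ← Finset.sum_add_distrib]
    simp only [map_add, smul_add])
  map_smul' c v := hom_ext (LinearMap.ext fun f => by
    rw [RingHom.id_apply, smul_hom, LinearMap.smul_apply, ofVector_hom_apply, ofVector_hom_apply,
      Finset.smul_sum]
    simp only [map_smul, smul_comm c])
  invFun f := by
    classical
    exact f.hom (Pi.single 1 (1 : k))
  left_inv v := by
    classical
    refine (ofVector_hom_apply hV v _).trans ?_
    rw [Finset.sum_eq_single 1]
    · simp
    · intro x _ hx
      rw [Pi.single_eq_of_ne hx, zero_smul]
    · simp
  right_inv f := by
    classical
    refine hom_ext (LinearMap.pi_ext' fun y => LinearMap.ext_ring ?_)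
    refine (ofVector_hom_apply hV _ _).trans ?_
    rw [Finset.sum_eq_single y]
    · rw [LinearMap.single_apply, Pi.single_eq_same, one_smul, ← f.map_ρ]
      change f.hom (Representation.rightTranslation k G y⁻¹ (Pi.single 1 (1 : k))) =
        f.hom (Pi.single y (1 : k))
      rw [rightTranslation_single, inv_inv, one_mul]
    · intro x _ hx
      rw [LinearMap.single_apply, Pi.single_eq_of_ne hx, zero_smul]
    · simp

end Yoneda

theorem trace_eq_of_equiv {V W H H' : Type*} [AddCommGroup V] [Module k V] [AddCommGroup W]
    [Module k W] [AddCommGroup H] [Module k H] [AddCommGroup H'] [Module k H'] (S : V ≃ₗ[k] H)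
    (L : H ≃ₗ[k] H') (S' : W ≃ₗ[k] H') {f : Module.End k V} {f' : Module.End k W} {b : H → H}
    {b' : H' → H'} (hS : ∀ v, S (f v) = b (S v)) (hL : ∀ x, L (b x) = b' (L x))
    (hS' : ∀ w, S' (f' w) = b' (S' w)) : LinearMap.trace k V f = LinearMap.trace k W f' := by
  have h : (S.trans (L.trans S'.symm)).conj f = f' := by
    refine LinearMap.ext fun w => S'.injective ?_
    rw [LinearEquiv.conj_apply_apply, hS']
    simp [hS, hL]
  rw [← h, LinearMap.trace_conj']

/-! ### Comparison of traces on an object and its dual. -/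

section Dualising

variable (F : DrinfeldCentre k G ⥤ DrinfeldCentre k G) [F.IsEquivalence] [F.Additive] [F.Linear k]

/-- The action of an equivalence on spaces of morphisms. -/
def mapLinearEquiv (V W : DrinfeldCentre k G) : (V ⟶ W) ≃ₗ[k] (F.obj V ⟶ F.obj W) :=
  LinearEquiv.ofBijective (F.mapLinearMap k) ⟨F.map_injective, F.map_surjective⟩

/-- The chain `V ≃ Hom(O, V) ≃ Hom(F O, F V) ≃ Hom(O, V*) ≃ V*`, with `O` the algebra of functions,
intertwines `h` on `V` with `φ h` on the dual, whose action is the transpose of that of `(φ h)⁻¹`.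
-/
theorem trace_eq_trace_inv (hF : IsDualising F) (θ : F.obj (functions k G) ≅ functions k G)
    {φ : MulAut G} (hφ : ∀ h, F.map (translate k h) ≫ θ.hom = θ.hom ≫ translate k (φ h))
    {V : DrinfeldCentre k G} (hV : V.grading 1 = ⊤) (h : G) :
    LinearMap.trace k V (V.ρ h) = LinearMap.trace k V (V.ρ (φ h)⁻¹) := by
  have := Fintype.ofFinite G
  obtain ⟨i⟩ := hF V
  have hV' : (dual V).grading 1 = ⊤ := grading_one_dual hV
  let L : (functions k G ⟶ V) ≃ₗ[k] (functions k G ⟶ dual V) :=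
    (mapLinearEquiv F _ _).trans
      ((Linear.homCongr k θ i : (F.obj (functions k G) ⟶ F.obj V) ≃ₗ[k]
        (functions k G ⟶ dual V)))
  have hL (f : functions k G ⟶ V) : L (translate k h ≫ f) = translate k (φ h) ≫ L f := by
    change θ.inv ≫ F.map (translate k h ≫ f) ≫ i.hom =
      translate k (φ h) ≫ θ.inv ≫ F.map f ≫ i.hom
    have h1 : θ.inv ≫ F.map (translate k h) = translate k (φ h) ≫ θ.inv := by
      rw [Iso.inv_comp_eq, ← Category.assoc, ← hφ, Category.assoc, Iso.hom_inv_id,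
        Category.comp_id]
    rw [F.map_comp, Category.assoc, reassoc_of% h1]
  have h1 : LinearMap.trace k V (V.ρ h) = LinearMap.trace k (dual V) ((dual V).ρ (φ h)) :=
    trace_eq_of_equiv (homFunctionsEquiv hV) L (homFunctionsEquiv hV')
      (fun v => (translate_comp_ofVector hV h v).symm) hL
      (fun l => (translate_comp_ofVector hV' (φ h) l).symm)
  exact h1.trans (LinearMap.trace_transpose' (V.ρ (φ h)⁻¹))

end Dualising

/-- A dualising braided autoequivalence of the Drinfeld centre of a finite group gives rise to a
class-inverting automorphism of the group. -/
theorem exists_isClassInverting [IsAlgClosed k] [CharZero k]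
    (h : HasDualisingBraidedAutoequivalence k (DrinfeldCentre k G)) :
    ∃ φ : MulAut G, IsClassInverting φ := by
  obtain ⟨F, _, _, _, _, hF⟩ := h
  obtain ⟨i⟩ := hF (functions k G)
  obtain ⟨θ, hθ⟩ := exists_iso F (functionsIsoDual.symm ≪≫ i.symm)
  obtain ⟨φ, hφ⟩ := exists_mulAut F θ
  refine ⟨φ, fun g => ?_⟩
  -- Every representation is an object in degree 1, so all characters agree on `g` and `(φ g)⁻¹`.
  have h1 : IsConj g (φ g)⁻¹ := Representation.isConj_of_trace_eq (k := k) fun V _ _ _ ρ =>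
    trace_eq_trace_inv F hF θ hφ (V := ofRep ρ) (ofRep_grading_one ρ) g
  obtain ⟨c, hc⟩ := isConj_iff.1 h1
  refine ⟨c, ?_⟩
  rw [← inv_inv (φ g), ← hc]
  group

end

end DrinfeldCentre

theorem mainTheorem6 :
    -- order of `M₁₁`
    Nat.card MathieuM11 = 7920 ∧
    -- `Out(M₁₁) = 1`
    Subsingleton (OuterAut MathieuM11) ∧
    -- Sylow 11-subgroups and their normalisers
    Nat.card (Sylow 11 MathieuM11) = 144 ∧
    (∀ P : Sylow 11 MathieuM11,
      Nat.card (Subgroup.normalizer ((P : Subgroup MathieuM11) : Set MathieuM11)) = 55) ∧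
    -- elements of order 11 exist, and none is conjugate to its inverse
    (∃ g : MathieuM11, orderOf g = 11) ∧
    (∀ g : MathieuM11, orderOf g = 11 → ¬ IsConj g g⁻¹) ∧
    -- there is a complex irreducible character that is not real-valued
    (∃ V : FDRep ℂ MathieuM11, Simple V ∧ ∃ g : MathieuM11, (V.character g).im ≠ 0) ∧
    -- there is no class-inverting automorphism
    (¬ ∃ φ : MulAut MathieuM11, IsClassInverting φ) ∧
    -- the Drinfeld centre has no dualising braided autoequivalence
    (∀ (k : Type u) [Field k] [IsAlgClosed k] [CharZero k],
      ¬ HasDualisingBraidedAutoequivalence k (DrinfeldCentre k MathieuM11)) := by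
  refine ⟨MathieuM11.card_eq, MathieuM11.subsingleton_outerAut,
    MathieuM11.card_sylow_and_normalizer.1, MathieuM11.card_sylow_and_normalizer.2,
    ⟨MathieuM11.r, MathieuM11.orderOf_r⟩, fun g hg => MathieuM11.not_isConj_inv hg, ?_,
    fun ⟨φ, hφ⟩ => MathieuM11.not_isClassInverting φ hφ, fun k _ _ _ h => ?_⟩
  · obtain ⟨W, hW, h⟩ := Representation.exists_simple_of_not_isConj_inv MathieuM11.not_isConj_r_inv
    exact ⟨W, hW, _, h⟩
  · obtain ⟨φ, hφ⟩ := DrinfeldCentre.exists_isClassInverting h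
    exact MathieuM11.not_isClassInverting φ hφ
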